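/- **Setting.** A game $G$ has a finite set of players $\mathrm{Agt}$, a finite state set $S=\biguplus_i S_i$, an initial state $s_{\rm init}$, nonempty action sets $\mathrm{Act}_i$, a transition function $\delta$ (in a state of $S_i$ the actions of $\mathrm{Act}_i$ are available) and, for each player $i$, a Muller objective $\phi_i=\{\rho\mid \mathrm{Inf}(\rho)\in\mathcal F_i\}$. A strategy of player $i$ maps each finite sequence of states ending in $S_i$ to an action of $\mathrm{Act}_i$; it is winning for an objective (from a state) if all runs compatible with it (from that state; from the initial state if none is named) belong to the objective. A strategy $\sigma_i$ is dominated by $\sigma_i'$ if $\sigma_i'$ satisfies $\phi_i$ against every profile of the others against which $\sigma_i$ does, and against at least one more; it is admissible if it is not dominated, and AA-winning if it is admissible and satisfies $\phi_i$ against all profiles of admissible strategies of the other players. $\mathrm{val}_i(s)=1$ if player $i$ has a winning strategy for $\phi_i$ from $s$, $-1$ if no run from $s$ satisfies $\phi_i$, and $0$ otherwise. Let $V_{i,x}=\{s\mid\mathrm{val}_i(s)=x\}$, $E_i=\{(s,a)\mid s\in S_i\Rightarrow \mathrm{val}_i(\delta(s,a))=\mathrm{val}_i(s)\}$, let $H_i$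 be the set of $s\in V_{i,0}\setminus S_i$ with two distinct successors of value $\ge 0$ for $i$, and $M_i=(\mathsf{GF}V_{i,1}\Rightarrow\phi_i)\wedge(\mathsf{GF}V_{i,0}\Rightarrow(\phi_i\vee\mathsf{GF}H_i))$. The game $G'_k$ is the product of $G$ with $\{\bot,0,\top\}$, started in $(s_{\rm init},0)$: from flag $0$, an edge outside $E_k$ sets the flag to $\bot$, an edge outside some $E_j$, $j\ne k$, sets it to $\top$; $\bot,\top$ are absorbing. Its objective is $$\Omega'_k=\bigl(\mathsf{GF}(S\times\{0\})\wedge M_k\wedge(\textstyle\bigwedge_{j\neq k}M_j\Rightarrow\phi_k)\bigr)\vee\bigl(\mathsf{GF}(S\times\{\top\})\wedge M_k\bigr).$$ **Abstraction.** Let $S^{a}=\biguplus_i S_i^{a}$ be finite and $\gamma:S^{a}\to2^{S}$ be such that the sets $\gamma(t)$ partition $S$ and $\gamma(t)\subseteq S_i$ for $t\in S_i^{a}$; let $\alpha(s)$ be the $t$ with $s\in\gamma(t)$. Assume that $\alpha(X)=\alpha(Y)$ implies $X\in\mathcal F_i\Leftrightarrow Y\in\mathcal F_i$, for all $i$ and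 $X,Y\subseteq S$. Let $\phi_i^{a}$ be the Muller condition on $S^{a}$ with family $\{X\mid\gamma(X)\in\mathcal F_i\}$ (intermediate states are ignored). For $t\in S_i^a$, $a\in\mathrm{Act}_i$ let $\Delta(t,a,u)$ hold iff $\delta(s,a)\in\gamma(u)$ for some $s\in\gamma(t)$, and $\mathrm{post}(t,a)=\{u\mid\Delta(t,a,u)\}$. For $C\subseteq\mathrm{Agt}$, in the two-player arena $\mathcal A^{C}$, from $t\in S^a_i$ the side of $i$ ($C$ or $-C$) chooses $a\in \mathrm{Act}_i$, leading to an intermediate state $(t,a)$, from which $C$ chooses some $u\in\mathrm{post}(t,a)$. $\mathrm{Win}_D(\mathcal A^C,\phi)$ is the set of $t\in S^a$ from which side $D$ wins $\phi$. Define $\overline V_{k,1}=\mathrm{Win}_{\{k\}}(\mathcal A^{\{k\}},\phi_k^a)$, $\overline V_{k,-1}=\mathrm{Win}_{\emptyset}(\mathcal A^{\emptyset},\neg\phi_k^a)$ with $\emptyset$ as the side $C$, $\overline V_{k,0}=\mathrm{Win}_{-k}(\mathcal A^{-k},\neg\phi^a_k)\cap\mathrm{Win}_{\mathrm{Agt}}(\mathcal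 A^{\mathrm{Agt}},\phi_k^a)$, $\underline V_{k,1}=\mathrm{Win}_{\{k\}}(\mathcal A^{-k},\phi_k^a)$, $\underline V_{k,-1}=\mathrm{Win}_{\emptyset}(\mathcal A^{\mathrm{Agt}},\neg\phi_k^a)$, and $\underline V_{k,0}=\nu X.\,\bigl(\mathrm{CPre}_k(X\cup\underline V_{k,1}\cup\underline V_{k,-1})\cap \mathrm{Win}_{-k}(\mathcal A^{\{k\}},\neg\phi_k^a)\cap\mathrm{Win}_{\mathrm{Agt}}(\mathcal A^{\emptyset},\phi_k^a)\bigr)$, where $\mathrm{CPre}_k(X)$ consists of the $t\in S^a_k$ with $\mathrm{post}(t,a)\subseteq X$ for some $a\in\mathrm{Act}_k$ and the $t\in S_i^a$, $i\ne k$, with $\mathrm{post}(t,a)\subseteq X$ for all $a\in\mathrm{Act}_i$. Let $\underline V_k=\bigcup_x\underline V_{k,x}$. Let $\overline E_k$ be the set of $(t,a)$ such that $t\in S^a_k$ implies that for some $x$, $t\in\overline V_{k,x}$ and $\mathrm{post}(t,a)\cap\bigcup_{l\ge x}\overline V_{k,l}\ne\emptyset$; $\underline E_k$ the set of $(t,a)$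 such that $t\notin\underline V_k$, or $t\in S^a_k$ implies that for some $x$, $t\in\underline V_{k,x}$ and $\mathrm{post}(t,a)\subseteq\bigcup_{l\ge x}\underline V_{k,l}$; $\overline H_k$ the set of $t\in\overline V_{k,0}\setminus S^a_k$ with $\Delta$-successors $u,u'$ (possibly equal) in $\overline V_{k,0}\cup\overline V_{k,1}$; $\underline H_k$ the set of $t\in\underline V_{k,0}\setminus S_k^a$ with available actions $a\ne b$ such that $\mathrm{post}(t,a)$, $\mathrm{post}(t,b)$ are disjoint and contained in $\underline V_{k,0}\cup\underline V_{k,1}$. Put $\underline M_k=(\mathsf{GF}\overline V_{k,1}\Rightarrow\phi^a_k)\wedge(\mathsf{GF}\overline V_{k,0}\Rightarrow(\phi^a_k\vee\mathsf{GF}\underline H_k))$ and $\overline M_k=(\mathsf{GF}\underline V_{k,1}\Rightarrow\phi^a_k)\wedge(\mathsf{GF}\underline V_{k,0}\Rightarrow(\phi^a_k\vee\mathsf{GF}\overline H_k))$. The abstract game $\mathcal A'_k$ is the product of $\mathcal A^{-k}$ with $\{\bot,0,\top\}$, started in $(\alpha(s_{\rm init}),0)$: from flag $0$, the flag becomes $\bot$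 when player $k$ plays outside $\underline E_k$ and $\top$ when a player $j\ne k$ plays outside $\overline E_j$; $\bot,\top$ are absorbing. Its objective for player $k$ is $$\underline\Omega'_k=\bigl(\mathsf{GF}(S^a\times\{0\})\wedge\underline M_k\wedge(\textstyle\bigwedge_{j\ne k}\overline M_j\Rightarrow\phi_k^a)\bigr)\vee\bigl(\mathsf{GF}(S^a\times\{\top\})\wedge\underline M_k\bigr).$$ The concretization of a strategy $\sigma$ of player $k$ in $\mathcal A'_k$ is the strategy $\gamma(\sigma)(h)=\sigma(\alpha(h))$ of $G$ (and of $G'_k$, ignoring the flags there), where $\alpha(h)$ is the history of $\mathcal A'_k$ obtained by applying $\alpha$ to the states, inserting the intermediate states and computing the flags of $\mathcal A'_k$; as $h$ shows states only, the inserted action of a step $s\to s'$ is the one prescribed by $\sigma$ if $s\in S_k$ and that action leads to $s'$, and $c(s,s')$ otherwise, for a fixed function $c$ choosing an available action from $s$ to $s'$ whenever there is one. **Theorem.** Let $k$ be a player with $\alpha(s_{\rm init})\in\underline V_k$, and let $\sigma$ be a strategy of player $k$ in $\mathcal A'_k$ that is winning for $\underline\Omega'_k$. Then, for every such $c$, the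 concretization $\gamma(\sigma)$ is winning for $\Omega'_k$ in $G'_k$, and it satisfies $\phi_k$ in $G$ against all profiles of admissible strategies of the other players. Moreover, player $k$ has an AA-winning strategy in $G$. -/

import Mathlib

open Filter

namespace AssumeAdmissible

/-! ### Runs and temporal conditions -/

/-- An alternating sequence of states and actions `s₀ a₀ s₁ a₁ …`. -/
structure Run (S A : Type*) where
  st : ℕ → S
  ac : ℕ → A

/-- The states strictly before position `n`, most recent first. -/
def past {S : Type*} (st : ℕ → S) : ℕ → List S
  | 0 => []
  | n + 1 => st n :: past st n

/-- The states occurring infinitely often. -/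
def Run.inf {S A : Type*} (ρ : Run S A) : Set S := {s | ∃ᶠ n in atTop, ρ.st n = s}

/-- `GF(B)`: the set `B` is visited infinitely often. -/
def GF {S A : Type*} (B : Set S) : Set (Run S A) := {ρ | ∃ᶠ n in atTop, ρ.st n ∈ B}

/-! ### Turn-based arenas

The actions available in a state are recorded per state, so that the same notions of strategy and
outcome apply to the abstract arenas, whose intermediate states have moves of another kind. -/

structure Arena (P S A : Type*) where
  owner : S → P
  init : S
  avail : S → Set A
  next : S → A → S

namespace Arena

variable {P S A : Type*}

def IsRun (G : Arena P S A) (ρ : Run S A) : Prop :=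
  ∀ n, ρ.ac n ∈ G.avail (ρ.st n) ∧ ρ.st (n + 1) = G.next (ρ.st n) (ρ.ac n)

/-- A strategy of player `i` chooses an available action after every finite sequence of states
ending in a state of player `i`. The sequence is given as the list of the earlier states (most
recent first) and the current state. Values at states of other players are irrelevant. -/
structure Strategy (G : Arena P S A) (i : P) where
  act : List S → S → A
  legal : ∀ h s, G.owner s = i → act h s ∈ G.avail s

/-- One strategy for each player. -/
abbrev Profile (G : Arena P S A) := ∀ i, G.Strategy i

def Compatible (G : Arena P S A) {i : P} (σ : G.Strategy i) (ρ : Run S A) : Prop :=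
  ∀ n, G.owner (ρ.st n) = i → ρ.ac n = σ.act (past ρ.st n) (ρ.st n)

/-- The runs from `s` compatible with the strategies of the players in `D`. -/
def Outcomes (G : Arena P S A) (s : S) (D : Set P) (σ : G.Profile) : Set (Run S A) :=
  {ρ | G.IsRun ρ ∧ ρ.st 0 = s ∧ ∀ i ∈ D, G.Compatible (σ i) ρ}

/-- The strategy `σ` of player `i` is winning from `s` for the objective `φ`. -/
def WinsFrom (G : Arena P S A) (s : S) {i : P} (σ : G.Strategy i) (φ : Set (Run S A)) : Prop :=
  ∀ ρ, G.IsRun ρ → ρ.st 0 = s → G.Compatible σ ρ → ρ ∈ φ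

/-- The states from which coalition `D` has a winning strategy profile for `φ`. -/
def Win (G : Arena P S A) (D : Set P) (φ : Set (Run S A)) : Set S :=
  {s | ∃ σ : G.Profile, G.Outcomes s D σ ⊆ φ}

/-- The outcome from the initial state of a complete strategy profile satisfies `φ`. -/
def Models (G : Arena P S A) (σ : G.Profile) (φ : Set (Run S A)) : Prop :=
  G.Outcomes G.init Set.univ σ ⊆ φ

open Classical in
/-- The profile `τ` with the strategy of player `i` replaced by `σ`. -/
noncomputable def subst (G : Arena P S A) {i : P} (σ : G.Strategy i) (τ : G.Profile) : G.Profile :=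
  Function.update τ i σ

/-- `σ` is (weakly) dominated by `σ'` for the objective `φ` of player `i`. -/
def Dominated (G : Arena P S A) (φ : Set (Run S A)) {i : P} (σ σ' : G.Strategy i) : Prop :=
  (∀ τ : G.Profile, G.Models (G.subst σ τ) φ → G.Models (G.subst σ' τ) φ) ∧
    ∃ τ : G.Profile, G.Models (G.subst σ' τ) φ ∧ ¬ G.Models (G.subst σ τ) φ

/-- The admissible strategies of player `i` when the objectives are `φ`. -/
def Adm (G : Arena P S A) (φ : P → Set (Run S A)) (i : P) : Set (G.Strategy i) :=
  {σ | ¬ ∃ σ' : G.Strategy i, G.Dominated (φ i) σ σ'}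

/-- `σ` achieves the objective of player `i` against all admissible strategies of the others. -/
def WinsAgainstAdm (G : Arena P S A) (φ : P → Set (Run S A)) {i : P} (σ : G.Strategy i) : Prop :=
  ∀ τ : G.Profile, (∀ j, j ≠ i → τ j ∈ G.Adm φ j) → G.Models (G.subst σ τ) (φ i)

/-- Assume-admissible winning strategies. -/
def AAWinning (G : Arena P S A) (φ : P → Set (Run S A)) {i : P} (σ : G.Strategy i) : Prop :=
  σ ∈ G.Adm φ i ∧ G.WinsAgainstAdm φ σ

end Arena

/-! ### Multiplayer Muller games -/

/-- A turn-based multiplayer game in which player `i` has the action set `Act i` (the actions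
used in the states of player `i`) and the Muller condition given by the family `F i`. -/
structure MullerGame (P S A : Type*) where
  owner : S → P
  init : S
  Act : P → Set A
  Act_nonempty : ∀ i, (Act i).Nonempty
  δ : S → A → S
  F : P → Set (Set S)

/-- The second component of the product games. -/
inductive Flag
  | bot
  | zero
  | top

namespace MullerGame

variable {P S A : Type*}

def arena (G : MullerGame P S A) : Arena P S A where
  owner := G.owner
  init := G.init
  avail s := G.Act (G.owner s)
  next := G.δ

/-- The objective of player `i`. -/
def obj (G : MullerGame P S A) (i : P) : Set (Run S A) := {ρ | ρ.inf ∈ G.F i}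

open Classical in
/-- The value of a state for player `i`. -/
noncomputable def val (G : MullerGame P S A) (i : P) (s : S) : SignType :=
  if ∃ σ : G.arena.Strategy i, G.arena.WinsFrom s σ (G.obj i) then 1
  else if ∀ σ : G.arena.Profile, ∀ ρ ∈ G.arena.Outcomes s Set.univ σ, ρ ∉ G.obj i then -1
  else 0

/-- `V i x`: the states of value `x` for player `i`. -/
def V (G : MullerGame P S A) (i : P) (x : SignType) : Set S := {s | G.val i s = x}

/-- The value-preserving edges of player `i`. -/
def E (G : MullerGame P S A) (i : P) : Set (S × A) :=
  {e | G.owner e.1 = i → G.val i (G.δ e.1 e.2) = G.val i e.1}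

/-- The successors of a state. -/
def succs (G : MullerGame P S A) (s : S) : Set S := G.δ s '' G.Act (G.owner s)

/-- The help states for player `i`. -/
def H (G : MullerGame P S A) (i : P) : Set S :=
  {s | G.owner s ≠ i ∧ G.val i s = 0 ∧
    ∃ s' ∈ G.succs s, ∃ s'' ∈ G.succs s, s' ≠ s'' ∧ 0 ≤ G.val i s' ∧ 0 ≤ G.val i s''}

/-- The prefix-independent part `M i` of the description of admissible outcomes. -/
def M (G : MullerGame P S A) (i : P) : Set (Run S A) :=
  {ρ | (ρ ∈ GF (G.V i 1) → ρ ∈ G.obj i) ∧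
    (ρ ∈ GF (G.V i 0) → ρ ∈ G.obj i ∨ ρ ∈ GF (G.H i))}

open Classical in
/-- Evolution of the second component in the product game for player `k`. -/
noncomputable def flagStep (G : MullerGame P S A) (k : P) (s : S) (a : A) : Flag → Flag
  | .bot => .bot
  | .top => .top
  | .zero =>
    if (s, a) ∉ G.E k then .bot
    else if ∃ j, j ≠ k ∧ (s, a) ∉ G.E j then .top
    else .zero

/-- The arena of the product game `G'ₖ`. -/
noncomputable def prodArena (G : MullerGame P S A) (k : P) : Arena P (S × Flag) A where
  owner p := G.owner p.1
  init := (G.init, .zero)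
  avail p := G.Act (G.owner p.1)
  next p a := (G.δ p.1 a, G.flagStep k p.1 a p.2)

/-- Projection of a run of the product game to the original game. -/
def proj (ρ : Run (S × Flag) A) : Run S A := ⟨fun n => (ρ.st n).1, ρ.ac⟩

/-- The objective `Ω'ₖ` of the product game `G'ₖ`. -/
def Omega' (G : MullerGame P S A) (k : P) : Set (Run (S × Flag) A) :=
  {ρ | (ρ ∈ GF {p | p.2 = Flag.zero} ∧ proj ρ ∈ G.M k ∧
        ((∀ j, j ≠ k → proj ρ ∈ G.M j) → proj ρ ∈ G.obj k)) ∨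
      (ρ ∈ GF {p | p.2 = Flag.top} ∧ proj ρ ∈ G.M k)}

/-- A strategy of the original game seen as a strategy of the product game. -/
def liftStrategy (G : MullerGame P S A) (k : P) (σ : G.arena.Strategy k) :
    (G.prodArena k).Strategy k where
  act h p := σ.act (h.map Prod.fst) p.1
  legal h p hp := σ.legal (h.map Prod.fst) p.1 hp

/-- `c s t` is an action leading from `s` to `t`, whenever there is one. Strategies observe
states only; such a function supplies the actions of a history from its states. -/
def IsEdgeLabelling (G : MullerGame P S A) (c : S → S → A) : Prop :=
  ∀ s, ∀ t ∈ G.succs s, c s t ∈ G.Act (G.owner s) ∧ G.δ s (c s t) = t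

theorem exists_isEdgeLabelling (G : MullerGame P S A) : ∃ c, G.IsEdgeLabelling c := by
  classical
  refine ⟨fun s t => if h : t ∈ G.succs s then h.choose
    else (G.Act_nonempty (G.owner s)).choose, fun s t ht => ?_⟩
  simp only [ht, dif_pos]
  exact ht.choose_spec

end MullerGame

/-! ### Abstractions -/

/-- A concretization function `γ` from abstract states `T` (each belonging to a player) whose
values partition the states and respect the players. -/
structure Abstraction {P S A : Type*} (G : MullerGame P S A) (T : Type*) where
  owner : T → P
  γ : T → Set S
  partition : ∀ s, ∃! t, s ∈ γ t
  owner_eq : ∀ t, ∀ s ∈ γ t, G.owner s = owner t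

/-- The two sides of the abstract arena for a coalition `C`: the coalition `C` itself, and its
complement. -/
inductive Side
  | coal
  | anti

namespace Abstraction

variable {P S A T : Type*} {G : MullerGame P S A}

/-- The abstraction function: `α s` is the unique `t` with `s ∈ γ t`. -/
noncomputable def α (abs : Abstraction G T) (s : S) : T := (abs.partition s).choose

theorem mem_γ_α (abs : Abstraction G T) (s : S) : s ∈ abs.γ (abs.α s) :=
  (abs.partition s).choose_spec.1

theorem owner_α (abs : Abstraction G T) (s : S) : abs.owner (abs.α s) = G.owner s :=
  (abs.owner_eq _ _ (abs.mem_γ_α s)).symm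

/-- The concretization of a set of abstract states. -/
def γSet (abs : Abstraction G T) (X : Set T) : Set S := ⋃ t ∈ X, abs.γ t

/-- The abstraction is compatible with all objectives: whether a set belongs to `F i` is
determined by its image under `α`. -/
def CompatibleObjectives (abs : Abstraction G T) : Prop :=
  ∀ i, ∀ X Y : Set S, abs.α '' X = abs.α '' Y → (X ∈ G.F i ↔ Y ∈ G.F i)

/-- The abstract Muller family: the condition for `F i` with each input `s` replaced
by `α s`. -/
def Fabs (abs : Abstraction G T) (i : P) : Set (Set T) := {X | abs.γSet X ∈ G.F i}

/-- The abstract transition relation. -/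
def Δ (abs : Abstraction G T) (s : T) (a : A) (t : T) : Prop :=
  a ∈ G.Act (abs.owner s) ∧ ∃ s' ∈ abs.γ s, ∃ t' ∈ abs.γ t, t' = G.δ s' a

def post (abs : Abstraction G T) (s : T) (a : A) : Set T := {t | abs.Δ s a t}

open Classical in
/-- The abstract successor when `t` is proposed after the action `a` in `s`: this is `t` itself
if it is a `Δ`-successor, and some fixed `Δ`-successor otherwise. -/
noncomputable def resolve (abs : Abstraction G T) (s : T) (a : A) (t : T) : T :=
  if abs.Δ s a t then t
  else if h : ∃ u, abs.Δ s a u then h.choose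
  else t

open Classical in
/-- The abstract arena in which coalition `C` plays against its complement and `C` resolves the
nondeterminism of `Δ` in the intermediate states `(s, a)`. -/
noncomputable def coalArena (abs : Abstraction G T) (C : Set P) :
    Arena Side (T ⊕ (T × A)) (A ⊕ T) where
  owner
    | .inl t => if abs.owner t ∈ C then .coal else .anti
    | .inr _ => .coal
  init := .inl (abs.α G.init)
  avail
    | .inl t => Sum.inl '' G.Act (abs.owner t)
    | .inr _ => Set.range Sum.inr
  next
    | .inl t, .inl a => .inr (t, a)
    | .inr (t, a), .inr u => .inl (abs.resolve t a u)
    | x, _ => x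

/-- The abstract objective of player `k` in the arenas `coalArena C`. -/
def objAbs (abs : Abstraction G T) (k : P) : Set (Run (T ⊕ (T × A)) (A ⊕ T)) :=
  {ρ | {t | ∃ᶠ n in atTop, ρ.st n = .inl t} ∈ abs.Fabs k}

/-- The abstract states from which side `D` wins `φ` in `coalArena C`. -/
def winAbs (abs : Abstraction G T) (C : Set P) (D : Side)
    (φ : Set (Run (T ⊕ (T × A)) (A ⊕ T))) : Set T :=
  {t | Sum.inl t ∈ (abs.coalArena C).Win {D} φ}

/-- Controllable predecessors for player `k`. -/
def cpre (abs : Abstraction G T) (k : P) (X : Set T) : Set T :=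
  {s | abs.owner s = k ∧ ∃ a ∈ G.Act k, abs.post s a ⊆ X} ∪
    {s | abs.owner s ≠ k ∧ ∀ a ∈ G.Act (abs.owner s), abs.post s a ⊆ X}

theorem cpre_mono (abs : Abstraction G T) (k : P) : Monotone (abs.cpre k) := by
  rintro X Y hXY s (⟨h, a, ha, hp⟩ | ⟨h, hp⟩)
  · exact Or.inl ⟨h, a, ha, hp.trans hXY⟩
  · exact Or.inr ⟨h, fun a ha => (hp a ha).trans hXY⟩

/-- Over-approximations of the sets of states of a given value. -/
def Vup (abs : Abstraction G T) (k : P) : SignType → Set T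
  | .pos => abs.winAbs {k} .coal (abs.objAbs k)
  | .neg => abs.winAbs ∅ .coal (abs.objAbs k)ᶜ
  | .zero => abs.winAbs {k}ᶜ .coal (abs.objAbs k)ᶜ ∩ abs.winAbs Set.univ .coal (abs.objAbs k)

def VlowPos (abs : Abstraction G T) (k : P) : Set T := abs.winAbs {k}ᶜ .anti (abs.objAbs k)

def VlowNeg (abs : Abstraction G T) (k : P) : Set T := abs.winAbs Set.univ .anti (abs.objAbs k)ᶜ

/-- The operator whose greatest fixpoint under-approximates the states of value `0`. -/
def zeroOp (abs : Abstraction G T) (k : P) : Set T →o Set T where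
  toFun X := abs.cpre k (X ∪ abs.VlowPos k ∪ abs.VlowNeg k) ∩
    (abs.winAbs {k} .anti (abs.objAbs k)ᶜ ∩ abs.winAbs ∅ .anti (abs.objAbs k))
  monotone' _ _ h := Set.inter_subset_inter_left _
    (abs.cpre_mono k (Set.union_subset_union_left _ (Set.union_subset_union_left _ h)))

/-- Under-approximations of the sets of states of a given value. -/
def Vlow (abs : Abstraction G T) (k : P) : SignType → Set T
  | .pos => abs.VlowPos k
  | .neg => abs.VlowNeg k
  | .zero => (abs.zeroOp k).gfp

/-- The union of the under-approximations over the three values. -/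
def VlowAll (abs : Abstraction G T) (k : P) : Set T := ⋃ x, abs.Vlow k x

/-- Over-approximation of the value-preserving edges. -/
def Eup (abs : Abstraction G T) (k : P) : Set (T × A) :=
  {e | abs.owner e.1 = k →
    ∃ x, e.1 ∈ abs.Vup k x ∧ (abs.post e.1 e.2 ∩ ⋃ l, ⋃ (_ : x ≤ l), abs.Vup k l).Nonempty}

/-- Under-approximation of the value-preserving edges. -/
def Elow (abs : Abstraction G T) (k : P) : Set (T × A) :=
  {e | abs.owner e.1 = k →
    ∃ x, e.1 ∈ abs.Vlow k x ∧ abs.post e.1 e.2 ⊆ ⋃ l, ⋃ (_ : x ≤ l), abs.Vlow k l} ∪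
  {e | e.1 ∉ abs.VlowAll k}

/-- Over-approximation of the help states. The two abstract successors may coincide. -/
def Hup (abs : Abstraction G T) (k : P) : Set T :=
  {s | s ∈ abs.Vup k 0 ∧ abs.owner s ≠ k ∧
    ∃ t ∈ abs.Vup k 0 ∪ abs.Vup k 1, ∃ u ∈ abs.Vup k 0 ∪ abs.Vup k 1,
      (∃ a, abs.Δ s a t) ∧ ∃ b, abs.Δ s b u}

/-- Under-approximation of the help states. -/
def Hlow (abs : Abstraction G T) (k : P) : Set T :=
  {s | s ∈ abs.Vlow k 0 ∧ abs.owner s ≠ k ∧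
    ∃ a ∈ G.Act (abs.owner s), ∃ b ∈ G.Act (abs.owner s), a ≠ b ∧
      abs.post s a ∩ abs.post s b = ∅ ∧
      abs.post s a ∪ abs.post s b ⊆ abs.Vlow k 0 ∪ abs.Vlow k 1}

/-! ### The abstract product game -/

/-- The states of the abstract product arena: pairs (abstract state, flag), and intermediate
states consisting of such a pair and an action. -/
abbrev PState (T A : Type*) := (T × Flag) ⊕ ((T × Flag) × A)

open Classical in
/-- Evolution of the flag: `⊥` when player `k` leaves `Elow k`, and `⊤` when another player `j`
leaves `Eup j`; both are absorbing. -/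
noncomputable def flagStep (abs : Abstraction G T) (k : P) (s : T) (a : A) : Flag → Flag
  | .bot => .bot
  | .top => .top
  | .zero =>
    if abs.owner s = k ∧ (s, a) ∉ abs.Elow k then .bot
    else if ∃ j, j ≠ k ∧ abs.owner s = j ∧ (s, a) ∉ abs.Eup j then .top
    else .zero

open Classical in
/-- The abstract product arena `A'ₖ`: player `k` is `Side.anti`, and the coalition of the other
players is `Side.coal`, which resolves the nondeterminism. -/
noncomputable def prodArena (abs : Abstraction G T) (k : P) :
    Arena Side (PState T A) (A ⊕ T) where
  owner
    | .inl p => if abs.owner p.1 = k then .anti else .coal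
    | .inr _ => .coal
  init := .inl (abs.α G.init, .zero)
  avail
    | .inl p => Sum.inl '' G.Act (abs.owner p.1)
    | .inr _ => Set.range Sum.inr
  next
    | .inl p, .inl a => .inr (p, a)
    | .inr (p, a), .inr u => .inl (abs.resolve p.1 a u, abs.flagStep k p.1 a p.2)
    | x, _ => x

/-- `GF(B)` for a set `B` of abstract states, in the abstract product arena. -/
def GFabs (B : Set T) : Set (Run (PState T A) (A ⊕ T)) := GF {q | ∃ t ∈ B, ∃ x, q = .inl (t, x)}

/-- `GF(T × {x})`, in the abstract product arena. -/
def GFflag (x : Flag) : Set (Run (PState T A) (A ⊕ T)) := GF {q | ∃ t, q = .inl (t, x)}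

/-- The abstract objective of player `i` in the abstract product arena. -/
def objProd (abs : Abstraction G T) (i : P) : Set (Run (PState T A) (A ⊕ T)) :=
  {ρ | {t | ∃ᶠ n in atTop, ∃ x, ρ.st n = .inl (t, x)} ∈ abs.Fabs i}

def Mlow (abs : Abstraction G T) (k : P) : Set (Run (PState T A) (A ⊕ T)) :=
  {ρ | (ρ ∈ GFabs (abs.Vup k 1) → ρ ∈ abs.objProd k) ∧
    (ρ ∈ GFabs (abs.Vup k 0) → ρ ∈ abs.objProd k ∨ ρ ∈ GFabs (abs.Hlow k))}

def Mup (abs : Abstraction G T) (k : P) : Set (Run (PState T A) (A ⊕ T)) :=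
  {ρ | (ρ ∈ GFabs (abs.Vlow k 1) → ρ ∈ abs.objProd k) ∧
    (ρ ∈ GFabs (abs.Vlow k 0) → ρ ∈ abs.objProd k ∨ ρ ∈ GFabs (abs.Hup k))}

/-- The under-approximated objective of player `k` in the abstract product arena. -/
def OmegaLow (abs : Abstraction G T) (k : P) : Set (Run (PState T A) (A ⊕ T)) :=
  {ρ | (ρ ∈ GFflag Flag.zero ∧ ρ ∈ abs.Mlow k ∧
        ((∀ j, j ≠ k → ρ ∈ abs.Mup j) → ρ ∈ abs.objProd k)) ∨
      (ρ ∈ GFflag Flag.top ∧ ρ ∈ abs.Mlow k)}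

/-! ### Concretization of strategies -/

/-- The action of `G` underlying a move of player `k` in the abstract product arena (moves of
player `k` are always of the first kind). -/
noncomputable def toAction (_abs : Abstraction G T) (k : P) : A ⊕ T → A
  | .inl a => a
  | .inr _ => (G.Act_nonempty k).choose

open Classical in
/-- The abstraction of a state history of `G` (earlier states, most recent first, and current
state): the earlier states in the abstract product arena, with the intermediate states inserted,
and the flag of the current one. The inserted action is the one prescribed by `σ` if this is a
state of player `k` and that action explains the step, and the one given by `c` otherwise. -/
noncomputable def absHist (abs : Abstraction G T) (k : P) (c : S → S → A)
    (σ : (abs.prodArena k).Strategy .anti) : List S → S → List (PState T A) × Flag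
  | [], _ => ([], .zero)
  | p :: ps, s =>
    let q := absHist abs k c σ ps p
    let m : T × Flag := (abs.α p, q.2)
    let b := abs.toAction k (σ.act q.1 (.inl m))
    let a := if G.owner p = k ∧ G.δ p b = s then b else c p s
    (.inr (m, a) :: .inl m :: q.1, abs.flagStep k m.1 a m.2)

/-- The concretization `h ↦ σ(α(h))` of a strategy of player `k` in the abstract product
arena. -/
noncomputable def concretize (abs : Abstraction G T) (k : P) (c : S → S → A)
    (σ : (abs.prodArena k).Strategy .anti) : G.arena.Strategy k where
  act h s := abs.toAction k
    (σ.act (abs.absHist k c σ h s).1 (.inl (abs.α s, (abs.absHist k c σ h s).2)))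
  legal h s hs := by
    have hs' : G.owner s = k := hs
    have h1 := σ.legal (abs.absHist k c σ h s).1 (.inl (abs.α s, (abs.absHist k c σ h s).2))
      (by simp [prodArena, owner_α, hs'])
    obtain ⟨a, ha, hEq⟩ := h1
    rw [← hEq]
    simpa [toAction, MullerGame.arena, owner_α] using ha

end Abstraction

end AssumeAdmissible

open AssumeAdmissible

/-! The proof combines a transfer from the abstract product game to the concrete one with a local
description of admissible strategies.

Transfer. A path that follows the concretization of `σ` is traced by an abstract run compatible with
`σ`: the coalition merely resolves the nondeterminism according to the concrete states. This run
lies in `OmegaLow` (`exists_abstract_run`). To read it concretely, the lower value sets must consist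
of states of the stated value and the upper ones must contain all of them (`val_of_mem_Vlow`,
`α_mem_Vup_val`). The upper set for value `0` requires a strategy of the opponents whenever player
`k` has none, which is determinacy of Muller games on finite graphs; this is proved by induction on
the size of the subgraph (`muller_determined`). Consequently `Mlow` implies `M`, and `M` implies
`Mup`. While the abstract flag is `0`, the value for `k` is known exactly. Hence the concrete flag
never becomes `⊥`, and it is `⊤` whenever the abstract one is (`flag_invariant`).

Admissibility. A strategy is admissible iff after every history compatible with it, it wins when the
value is `1` and can still win when the value is `0` (`mem_Adm_of_achievesVal`,
`achievesVal_of_mem_Adm`). Thus an admissible player never lowers the own value, and the outcome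
satisfies `M`. Against admissible opponents the flag `⊤` is therefore unreachable, and the first
disjunct of `Omega'` yields the objective (`winsAgainstAdm_of_wins_prod`).

Existence. The concretization need not be admissible. Replacing it after each history where it fails
to achieve the value makes it so (`improved`). No win is lost: along a winning path a replacement
first happens at a state of value `1`, and from there the improved strategy wins. -/

namespace AssumeAdmissible

/-! ### Shifting sequences -/

section Shift

variable {S : Type*}

theorem past_succ (x : ℕ → S) (n : ℕ) : past x (n + 1) = x n :: past x n := rfl

theorem length_past (x : ℕ → S) (n : ℕ) : (past x n).length = n := by
  induction n with
  | zero => rfl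
  | succ n ih => simp [past_succ, ih]

theorem past_congr {x y : ℕ → S} {n : ℕ} (h : ∀ m < n, x m = y m) : past x n = past y n := by
  induction n with
  | zero => rfl
  | succ n ih => rw [past_succ, past_succ, h n (by omega), ih fun m hm => h m (by omega)]

theorem eq_of_past_eq {x y : ℕ → S} {n : ℕ} (h : past x n = past y n) : ∀ m < n, x m = y m := by
  induction n with
  | zero => intro m hm; omega
  | succ n ih =>
    rw [past_succ, past_succ, List.cons.injEq] at h
    intro m hm
    rcases Nat.lt_succ_iff_lt_or_eq.1 hm with hm | rfl
    · exact ih h.2 m hm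
    · exact h.1

theorem past_add (x : ℕ → S) (n m : ℕ) :
    past x (n + m) = past (fun j => x (n + j)) m ++ past x n := by
  induction m with
  | zero => rfl
  | succ m ih => rw [← Nat.add_assoc, past_succ, ih]; rfl

/-- The elements occurring infinitely often in a sequence. -/
def infSet (x : ℕ → S) : Set S := {s | ∃ᶠ n in atTop, x n = s}

theorem frequently_shift (p : ℕ → Prop) (n : ℕ) :
    (∃ᶠ m in atTop, p (n + m)) ↔ ∃ᶠ m in atTop, p m := by
  simp only [frequently_atTop]
  constructor
  · intro h a
    obtain ⟨b, hb, hp⟩ := h a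
    exact ⟨n + b, by omega, hp⟩
  · intro h a
    obtain ⟨b, hb, hp⟩ := h (n + a)
    exact ⟨b - n, by omega, by rwa [Nat.add_sub_cancel' (by omega)]⟩

theorem infSet_shift (x : ℕ → S) (n : ℕ) : infSet (fun m => x (n + m)) = infSet x := by
  ext s
  exact frequently_shift (fun m => x m = s) n

end Shift

/-! ### Determinacy of Muller games on finite graphs -/

section Determinacy

variable {S : Type*} {own : S → Bool} {E : S → S → Prop} {W : Set S} {p : Bool}

/-- The infinite paths of the graph `E` inside `W`. -/
def IsPlay (E : S → S → Prop) (W : Set S) (x : ℕ → S) : Prop :=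
  ∀ n, x n ∈ W ∧ E (x n) (x (n + 1))

/-- No vertex of `W` is a dead end of the subgraph induced on `W`. -/
def IsSubarena (E : S → S → Prop) (W : Set S) : Prop := ∀ s ∈ W, ∃ t ∈ W, E s t

/-- The moves of player `p` prescribed by `f` (from the earlier vertices, most recent first, and
the current one) are moves inside `W`. -/
def IsLegal (own : S → Bool) (E : S → S → Prop) (W : Set S) (p : Bool) (f : List S → S → S) :
    Prop :=
  ∀ l, ∀ s ∈ W, own s = p → f l s ∈ W ∧ E s (f l s)

def Follows (own : S → Bool) (p : Bool) (f : List S → S → S) (x : ℕ → S) : Prop :=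
  ∀ n, own (x n) = p → x (n + 1) = f (past x n) (x n)

/-- The vertices from which player `p` wins `Φ` in the game restricted to `W`. -/
def GWin (own : S → Bool) (E : S → S → Prop) (W : Set S) (p : Bool) (Φ : (ℕ → S) → Prop) : Set S :=
  {s | ∃ f, IsLegal own E W p f ∧ ∀ x, IsPlay E W x → x 0 = s → Follows own p f x → Φ x}

/-- The objective contains every sequence that has a suffix in it. -/
def PrefixClosed (Φ : (ℕ → S) → Prop) : Prop := ∀ x n, Φ (fun m => x (n + m)) → Φ x

theorem IsPlay.shift {x : ℕ → S} (hx : IsPlay E W x) (n : ℕ) :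
    IsPlay E W (fun m => x (n + m)) := fun m => hx (n + m)

theorem GWin.mono {Φ Ψ : (ℕ → S) → Prop} (h : ∀ x, IsPlay E W x → Φ x → Ψ x) :
    GWin own E W p Φ ⊆ GWin own E W p Ψ := by
  rintro s ⟨f, hf, hw⟩
  exact ⟨f, hf, fun x hx h0 hc => h x hx (hw x hx h0 hc)⟩

/-- There is a legal strategy that moves to `D` whenever this is possible. -/
theorem exists_isLegal_of_target (hW : IsSubarena E W) (D : Set S) :
    ∃ f : List S → S → S, IsLegal own E W p f ∧
      ∀ l, ∀ s ∈ W, (∃ t ∈ W, E s t ∧ t ∈ D) → f l s ∈ D := by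
  have key : ∀ s, ∃ t, s ∈ W → (t ∈ W ∧ E s t) ∧ ((∃ t ∈ W, E s t ∧ t ∈ D) → t ∈ D) := by
    intro s
    by_cases h : ∃ t ∈ W, E s t ∧ t ∈ D
    · obtain ⟨t, h1, h2, h3⟩ := h
      exact ⟨t, fun _ => ⟨⟨h1, h2⟩, fun _ => h3⟩⟩
    · by_cases hs : s ∈ W
      · obtain ⟨t, ht⟩ := hW s hs
        exact ⟨t, fun _ => ⟨ht, fun h' => absurd h' h⟩⟩
      · exact ⟨s, fun h => absurd h hs⟩
  choose g hg using key
  exact ⟨fun _ => g, fun _ s hs _ => (hg s hs).1, fun _ s hs h => (hg s hs).2 h⟩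

open Classical in
/-- The first vertex of a history lying in `D`, and the earlier part of the history from there. -/
noncomputable def sinceFirst (D : Set S) : List S → S → Option (S × List S)
  | [], s => if s ∈ D then some (s, []) else none
  | q :: h, s =>
    match sinceFirst D h q with
    | some r => some (r.1, q :: r.2)
    | none => if s ∈ D then some (s, []) else none

theorem sinceFirst_eq_none {D : Set S} {x : ℕ → S} {n : ℕ} (h : ∀ m ≤ n, x m ∉ D) :
    sinceFirst D (past x n) (x n) = none := by
  induction n with
  | zero => simp [past, sinceFirst, h 0 le_rfl]
  | succ n ih =>
    rw [past_succ, sinceFirst, ih fun m hm => h m (by omega)]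
    simp [h (n + 1) le_rfl]

theorem sinceFirst_eq_some {D : Set S} {x : ℕ → S} {n : ℕ} (h : ∀ m < n, x m ∉ D) (hn : x n ∈ D)
    (m : ℕ) :
    sinceFirst D (past x (n + m)) (x (n + m)) = some (x n, past (fun j => x (n + j)) m) := by
  induction m with
  | zero =>
    cases n with
    | zero => simp [past, sinceFirst, hn]
    | succ n =>
      rw [Nat.add_zero, past_succ, sinceFirst, sinceFirst_eq_none fun m hm => h m (by omega)]
      simp [hn, past]
  | succ m ih => rw [← Nat.add_assoc, past_succ, sinceFirst, ih]; rfl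

/-- A strategy that either achieves `Φ` or reaches the winning region can be continued to a winning
strategy. -/
theorem GWin.of_reach {Φ : (ℕ → S) → Prop} (hΦ : PrefixClosed Φ) {s : S}
    (hs : s ∈ GWin own E W p fun x => Φ x ∨ ∃ n, x n ∈ GWin own E W p Φ) :
    s ∈ GWin own E W p Φ := by
  classical
  obtain ⟨g, hg, hgw⟩ := hs
  have key : ∀ u, ∃ f, IsLegal own E W p f ∧ (u ∈ GWin own E W p Φ →
      ∀ x, IsPlay E W x → x 0 = u → Follows own p f x → Φ x) := by
    intro u
    by_cases hu : u ∈ GWin own E W p Φ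
    · obtain ⟨f, hf, hw⟩ := hu
      exact ⟨f, hf, fun _ => hw⟩
    · exact ⟨g, hg, fun h => absurd h hu⟩
  choose f hf hw using key
  set D := GWin own E W p Φ with hD
  refine ⟨fun l t => match sinceFirst D l t with
    | some r => f r.1 r.2 t
    | none => g l t, fun l t ht ho => ?_, fun x hx h0 hc => ?_⟩
  · beta_reduce
    cases sinceFirst D l t with
    | some r => exact hf _ _ t ht ho
    | none => exact hg _ t ht ho
  · by_cases hex : ∃ n, x n ∈ D
    · have hlt : ∀ m < Nat.find hex, x m ∉ D := fun m hm => Nat.find_min hex hm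
      refine hΦ x (Nat.find hex) (hw _ (Nat.find_spec hex) _ (hx.shift _) rfl fun m ho => ?_)
      have := hc _ ho
      beta_reduce at this
      rwa [sinceFirst_eq_some hlt (Nat.find_spec hex)] at this
    · refine (hgw x hx h0 fun n ho => ?_).resolve_right hex
      have := hc n ho
      beta_reduce at this
      rwa [sinceFirst_eq_none fun m _ hm => hex ⟨m, hm⟩] at this

theorem GWin.of_exists_edge {Φ : (ℕ → S) → Prop} (hΦ : PrefixClosed Φ) (hW : IsSubarena E W)
    {s : S} (hs : s ∈ W) (ho : own s = p) (h : ∃ t ∈ W, E s t ∧ t ∈ GWin own E W p Φ) :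
    s ∈ GWin own E W p Φ := by
  obtain ⟨f, hf, hD⟩ := exists_isLegal_of_target (own := own) (p := p) hW (GWin own E W p Φ)
  refine GWin.of_reach hΦ ⟨f, hf, fun x hx h0 hc => Or.inr ⟨1, ?_⟩⟩
  subst h0
  rw [hc 0 ho]
  exact hD _ _ hs h

theorem GWin.of_forall_edge {Φ : (ℕ → S) → Prop} (hΦ : PrefixClosed Φ) (hW : IsSubarena E W)
    {s : S} (h : ∀ t ∈ W, E s t → t ∈ GWin own E W p Φ) : s ∈ GWin own E W p Φ := by
  obtain ⟨f, hf, -⟩ := exists_isLegal_of_target (own := own) (p := p) hW (GWin own E W p Φ)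
  refine GWin.of_reach hΦ ⟨f, hf, fun x hx h0 hc => Or.inr ⟨1, ?_⟩⟩
  exact h _ (hx 1).1 (h0 ▸ (hx 0).2)

theorem isSubarena_diff_GWin {Φ : (ℕ → S) → Prop} (hΦ : PrefixClosed Φ) (hW : IsSubarena E W) :
    IsSubarena E (W \ GWin own E W p Φ) := by
  rintro s ⟨hs, hn⟩
  by_contra hcon
  push Not at hcon
  exact hn (GWin.of_forall_edge hΦ hW fun t ht he => by_contra fun hd => hcon t ⟨ht, hd⟩ he)

/-- An edge from a vertex of `p` into the winning region would put that vertex into the region.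
Outside the region `p` is therefore trapped, which lets strategies of the opponent in the subgame be
used in the whole game. -/
theorem trap_diff_GWin {Φ : (ℕ → S) → Prop} (hΦ : PrefixClosed Φ) (hW : IsSubarena E W)
    {s t : S} (hs : s ∈ W \ GWin own E W p Φ) (ho : own s = p) (ht : t ∈ W) (he : E s t) :
    t ∈ W \ GWin own E W p Φ :=
  ⟨ht, fun hd => hs.2 (GWin.of_exists_edge hΦ hW hs.1 ho ⟨t, ht, he, hd⟩)⟩

/-- Winning in a subgame that the opponent cannot leave. -/
theorem GWin.of_trap {Φ : (ℕ → S) → Prop} {W' : Set S} (hW : IsSubarena E W) (hsub : W' ⊆ W)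
    (htrap : ∀ s ∈ W', own s ≠ p → ∀ t ∈ W, E s t → t ∈ W') {s : S} (hs : s ∈ W')
    (hwin : s ∈ GWin own E W' p Φ) : s ∈ GWin own E W p Φ := by
  classical
  obtain ⟨f, hf, hw⟩ := hwin
  obtain ⟨g, hg, -⟩ := exists_isLegal_of_target (own := own) (p := p) hW ∅
  refine ⟨fun l t => if t ∈ W' then f l t else g l t, fun l t ht ho => ?_, fun x hx h0 hc => ?_⟩
  · by_cases h : t ∈ W'
    · simp only [h, if_true]
      exact ⟨hsub (hf l t h ho).1, (hf l t h ho).2⟩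
    · simp only [h, if_false]
      exact hg l t ht ho
  · have hin : ∀ n, x n ∈ W' := by
      intro n
      induction n with
      | zero => rwa [h0]
      | succ n ih =>
        by_cases ho : own (x n) = p
        · have := hc n ho
          beta_reduce at this
          rw [if_pos ih] at this
          rw [this]
          exact (hf _ _ ih ho).1
        · exact htrap _ ih ho _ (hx (n + 1)).1 (hx n).2
    exact hw x (fun n => ⟨hin n, (hx n).2⟩) h0 fun n ho => (hc n ho).trans (if_pos (hin n))

/-- A strategy of a subgame wins as long as the play does not leave the subgame. -/
theorem GWin.of_subgame {Φ : (ℕ → S) → Prop} {W' : Set S} (hW : IsSubarena E W) (hsub : W' ⊆ W)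
    {s : S} (hwin : s ∈ GWin own E W' p Φ) :
    s ∈ GWin own E W p fun x => Φ x ∨ ∃ n, x n ∈ W \ W' := by
  classical
  obtain ⟨f, hf, hw⟩ := hwin
  obtain ⟨g, hg, -⟩ := exists_isLegal_of_target (own := own) (p := p) hW ∅
  refine ⟨fun l t => if t ∈ W' then f l t else g l t, fun l t ht ho => ?_, fun x hx h0 hc => ?_⟩
  · by_cases h : t ∈ W'
    · simp only [h, if_true]
      exact ⟨hsub (hf l t h ho).1, (hf l t h ho).2⟩
    · simp only [h, if_false]
      exact hg l t ht ho
  · by_cases hin : ∀ n, x n ∈ W'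
    · exact Or.inl (hw x (fun n => ⟨hin n, (hx n).2⟩) h0 fun n ho => (hc n ho).trans (if_pos (hin n)))
    · push Not at hin
      obtain ⟨n, hn⟩ := hin
      exact Or.inr ⟨n, (hx n).1, hn⟩

open Classical in
/-- The current phase of a strategy that visits `v 0`, `v 1`, … in turn: the index of the current
target, the vertex where the phase started, and the earlier part of the history from there. -/
noncomputable def phase (v : ℕ → S) : List S → S → ℕ × S × List S
  | [], s => (0, s, [])
  | q :: h, s =>
    if q = v (phase v h q).1 then ((phase v h q).1 + 1, s, [])
    else ((phase v h q).1, (phase v h q).2.1, q :: (phase v h q).2.2)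

theorem phase_of_start {v : ℕ → S} {x : ℕ → S} {n i : ℕ}
    (hn : phase v (past x n) (x n) = (i, x n, [])) (m : ℕ) (h : ∀ j < m, x (n + j) ≠ v i) :
    phase v (past x (n + m)) (x (n + m)) = (i, x n, past (fun j => x (n + j)) m) := by
  induction m with
  | zero => exact hn
  | succ m ih =>
    have := ih fun j hj => h j (by omega)
    rw [← Nat.add_assoc, past_succ, phase, this, if_neg (h m (by omega))]
    rfl

/-- If every target of a sequence can be reached unless `Φ` holds, then they can all be reached in
turn unless `Φ` holds. -/
theorem GWin.of_reach_all {Φ : (ℕ → S) → Prop} (hΦ : PrefixClosed Φ) (v : ℕ → S)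
    (h : ∀ i, ∀ s ∈ W, s ∈ GWin own E W p fun x => Φ x ∨ ∃ n, x n = v i) {s : S} (hs : s ∈ W) :
    s ∈ GWin own E W p fun x => Φ x ∨ ∀ i, ∃ n ≥ i, x n = v i := by
  classical
  have key : ∀ i u, ∃ f, IsLegal own E W p f ∧ (u ∈ W →
      ∀ x, IsPlay E W x → x 0 = u → Follows own p f x → Φ x ∨ ∃ n, x n = v i) := by
    intro i u
    by_cases hu : u ∈ W
    · obtain ⟨f, hf, hw⟩ := h i u hu
      exact ⟨f, hf, fun _ => hw⟩
    · obtain ⟨f, hf, -⟩ := h i s hs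
      exact ⟨f, hf, fun h => absurd h hu⟩
  choose f hf hw using key
  refine ⟨fun l t => f (phase v l t).1 (phase v l t).2.1 (phase v l t).2.2 t,
    fun l t ht ho => hf _ _ _ t ht ho, fun x hx h0 hc => or_iff_not_imp_left.2 fun hnot => ?_⟩
  have step : ∀ n i, phase v (past x n) (x n) = (i, x n, []) → ∃ m, x (n + m) = v i ∧
      phase v (past x (n + m + 1)) (x (n + m + 1)) = (i + 1, x (n + m + 1), []) := by
    intro n i hn
    have hex : ∃ m, x (n + m) = v i := by
      by_contra hcon
      push Not at hcon
      rcases hw i (x n) (hx n).1 _ (hx.shift n) rfl (fun m ho => by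
        have := hc _ ho
        beta_reduce at this
        rwa [phase_of_start hn m fun j _ => hcon j] at this) with h1 | ⟨m, hm⟩
      · exact hnot (hΦ x n h1)
      · exact hcon m hm
    refine ⟨Nat.find hex, Nat.find_spec hex, ?_⟩
    rw [past_succ, phase, phase_of_start hn _ fun j hj => Nat.find_min hex hj,
      if_pos (Nat.find_spec hex)]
  -- A phase ends one move after its target is met, even if the target is its first vertex. So every
  -- phase takes at least one move, and phase `i` starts no earlier than time `i`.
  have start : ∀ i, ∃ n ≥ i, phase v (past x n) (x n) = (i, x n, []) := by
    intro i
    induction i with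
    | zero => exact ⟨0, le_rfl, rfl⟩
    | succ i ih =>
      obtain ⟨n, hn, hp⟩ := ih
      obtain ⟨m, -, hm⟩ := step n i hp
      exact ⟨n + m + 1, by omega, hm⟩
  intro i
  obtain ⟨n, hn, hp⟩ := start i
  obtain ⟨m, hm, -⟩ := step n i hp
  exact ⟨n + m, by omega, hm⟩

theorem exists_frequent_enumeration [Finite S] (hW : W.Nonempty) :
    ∃ v : ℕ → S, (∀ i, v i ∈ W) ∧ ∀ w ∈ W, ∀ N, ∃ i ≥ N, v i = w := by
  have : Nonempty W := hW.to_subtype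
  obtain ⟨e, he⟩ := exists_surjective_nat W
  -- Reading only the second component of a pair repeats every index infinitely often: the codes of
  -- the pairs `(N, j)` are at least `N`.
  refine ⟨fun i => e i.unpair.2, fun i => (e _).2, fun w hw N => ?_⟩
  obtain ⟨j, hj⟩ := he ⟨w, hw⟩
  exact ⟨Nat.pair N j, Nat.left_le_pair N j, by simp [hj]⟩

theorem prefixClosed_muller (F : Set (Set S)) : PrefixClosed fun x : ℕ → S => infSet x ∈ F :=
  fun x n h => (congrArg (· ∈ F) (infSet_shift x n)).mp h

theorem PrefixClosed.or_visits {Φ : (ℕ → S) → Prop} (hΦ : PrefixClosed Φ) (v : S) :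
    PrefixClosed fun x => Φ x ∨ ∃ n, x n = v := by
  rintro x n (h | ⟨m, hm⟩)
  · exact Or.inl (hΦ x n h)
  · exact Or.inr ⟨n + m, hm⟩

/-- Determinacy of Muller games on a finite graph, assuming it for smaller subgraphs and that player
`p` wins the plays visiting all of `W` infinitely often. -/
theorem muller_determined_step [Finite S] (F : Set (Set S)) (hW : IsSubarena E W) (hF : W ∈ F)
    (ih : ∀ W', W' ⊂ W → IsSubarena E W' → ∀ s ∈ W',
      s ∈ GWin own E W' p (fun x => infSet x ∈ F) ∨ s ∈ GWin own E W' (!p) (fun x => infSet x ∉ F))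
    {s : S} (hs : s ∈ W) :
    s ∈ GWin own E W p (fun x => infSet x ∈ F) ∨ s ∈ GWin own E W (!p) (fun x => infSet x ∉ F) := by
  have hΦ := prefixClosed_muller F
  have hΦ' : PrefixClosed fun x : ℕ → S => infSet x ∉ F := prefixClosed_muller Fᶜ
  -- If the opponent wins somewhere, the opponent's region can be removed and induction applies to
  -- the rest. A win of the opponent there would extend to the whole game, since leaving the rest
  -- means entering the region.
  by_cases hA : ∃ u ∈ W, u ∈ GWin own E W (!p) (fun x => infSet x ∉ F)
  · obtain ⟨u, huW, hu⟩ := hA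
    by_cases hsA : s ∈ GWin own E W (!p) (fun x => infSet x ∉ F)
    · exact Or.inr hsA
    have hss : W \ GWin own E W (!p) (fun x => infSet x ∉ F) ⊂ W :=
      ⟨Set.sdiff_subset, fun h => (h huW).2 hu⟩
    rcases ih _ hss (isSubarena_diff_GWin hΦ' hW) s ⟨hs, hsA⟩ with h | h
    · refine Or.inl (GWin.of_trap hW Set.sdiff_subset (fun t ht ho r hr he => ?_) ⟨hs, hsA⟩ h)
      exact trap_diff_GWin hΦ' hW ht (by revert ho; cases own t <;> cases p <;> simp) hr he
    · refine absurd (GWin.of_reach hΦ' (GWin.mono ?_ (GWin.of_subgame hW Set.sdiff_subset h))) hsA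
      rintro x - (h | ⟨n, h1, h2⟩)
      · exact Or.inl h
      · exact Or.inr ⟨n, by_contra fun h => h2 ⟨h1, h⟩⟩
  · push Not at hA
    left
    -- Outside the region from which `p` forces a visit to `v`, the smaller subgame is determined. A
    -- win of the opponent there would be a win in `W`, because `p` cannot leave that subgame; this
    -- is excluded. So `p` wins there unless the play enters the region.
    have reach : ∀ v ∈ W, ∀ t ∈ W, t ∈ GWin own E W p fun x => infSet x ∈ F ∨ ∃ n, x n = v := by
      intro v hv t ht
      have hV : PrefixClosed fun x : ℕ → S => ∃ n, x n = v := by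
        rintro x n ⟨m, hm⟩
        exact ⟨n + m, hm⟩
      by_cases htB : t ∈ GWin own E W p fun x => ∃ n, x n = v
      · exact GWin.mono (fun _ _ => Or.inr) htB
      have hvB : v ∈ GWin own E W p fun x => ∃ n, x n = v := by
        obtain ⟨f, hf, -⟩ := exists_isLegal_of_target (own := own) (p := p) hW ∅
        exact ⟨f, hf, fun x _ h0 _ => ⟨0, h0⟩⟩
      have hss : W \ GWin own E W p (fun x => ∃ n, x n = v) ⊂ W :=
        ⟨Set.sdiff_subset, fun h => (h hv).2 hvB⟩
      rcases ih _ hss (isSubarena_diff_GWin hV hW) t ⟨ht, htB⟩ with h | h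
      · refine GWin.of_reach (hΦ.or_visits v) (GWin.mono ?_ (GWin.of_subgame hW Set.sdiff_subset h))
        rintro x - (h | ⟨n, h1, h2⟩)
        · exact Or.inl (Or.inl h)
        · exact Or.inr ⟨n, GWin.mono (fun _ _ => Or.inr) (by_contra fun h => h2 ⟨h1, h⟩)⟩
      · refine absurd (GWin.of_trap hW Set.sdiff_subset (fun r hr ho q hq he => ?_) ⟨ht, htB⟩ h)
          (hA t ht)
        exact trap_diff_GWin hV hW hr (by revert ho; cases own r <;> cases p <;> simp) hq he
    obtain ⟨v, hv, hfreq⟩ := exists_frequent_enumeration ⟨s, hs⟩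
    refine GWin.mono ?_ (GWin.of_reach_all hΦ v (fun i => reach _ (hv i)) hs)
    rintro x hx (h | h)
    · exact h
    -- Visiting all vertices in turn forever makes the set of recurring vertices exactly `W`, which
    -- lies in `F`.
    · suffices infSet x = W by rwa [this]
      ext w
      constructor
      · intro hw
        obtain ⟨n, hn⟩ := hw.exists
        exact hn ▸ (hx n).1
      · intro hw
        refine frequently_atTop.2 fun N => ?_
        obtain ⟨i, hi, rfl⟩ := hfreq w hw N
        obtain ⟨n, hn, h⟩ := h i
        exact ⟨n, by omega, h⟩

/-- Muller games on finite graphs are determined. -/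
theorem muller_determined [Finite S] (own : S → Bool) (E : S → S → Prop) (F : Set (Set S))
    (p : Bool) (W : Set S) (hW : IsSubarena E W) (s : S) (hs : s ∈ W) :
    s ∈ GWin own E W p (fun x => infSet x ∈ F) ∨ s ∈ GWin own E W (!p) (fun x => infSet x ∉ F) := by
  induction hn : W.ncard using Nat.strong_induction_on generalizing W s with
  | _ n ih =>
    subst hn
    have ih' : ∀ W', W' ⊂ W → IsSubarena E W' → ∀ s ∈ W', s ∈ GWin own E W' p (fun x => infSet x ∈ F) ∨
        s ∈ GWin own E W' (!p) (fun x => infSet x ∉ F) := fun W' hss hW' s hs =>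
      ih _ (Set.ncard_lt_ncard hss) W' hW' s hs rfl
    by_cases hF : W ∈ F
    · exact muller_determined_step F hW hF ih' hs
    -- If `W ∉ F`, the roles of the two players are exchanged and the family is complemented.
    · have := muller_determined_step (p := !p) Fᶜ hW hF (fun W' hss hW' s hs => by
        simpa [or_comm] using ih' W' hss hW' s hs) hs
      simpa [or_comm] using this

end Determinacy


/-! ### Paths and plays of a Muller game -/

namespace MullerGame

variable {P S A : Type*}

/-- The infinite paths of a game. -/
def IsPath (G : MullerGame P S A) (x : ℕ → S) : Prop := ∀ n, x (n + 1) ∈ G.succs (x n)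

/-- The moves along `x` in the states owned by `C` are those prescribed by `f`. -/
def FollowsOn (G : MullerGame P S A) (C : Set P) (f : List S → S → A) (x : ℕ → S) : Prop :=
  ∀ n, G.owner (x n) ∈ C → x (n + 1) = G.δ (x n) (f (past x n) (x n))

/-- All prescribed actions are available. -/
def IsLegalPlan (G : MullerGame P S A) (f : List S → S → A) : Prop :=
  ∀ h s, f h s ∈ G.Act (G.owner s)

/-- The coalition `C` wins `Φ` from `s`. -/
def CoalWins (G : MullerGame P S A) (C : Set P) (s : S) (Φ : (ℕ → S) → Prop) : Prop :=
  ∃ f, G.IsLegalPlan f ∧ ∀ x, x 0 = s → G.IsPath x → G.FollowsOn C f x → Φ x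

noncomputable def defaultAct (G : MullerGame P S A) (s : S) : A := (G.Act_nonempty (G.owner s)).choose

theorem defaultAct_mem (G : MullerGame P S A) (s : S) : G.defaultAct s ∈ G.Act (G.owner s) :=
  (G.Act_nonempty (G.owner s)).choose_spec

/-- The history and the current state after `n` moves from `s` if all players follow `f`. -/
def playState (G : MullerGame P S A) (f : List S → S → A) (s : S) : ℕ → List S × S
  | 0 => ([], s)
  | n + 1 =>
    let r := playState G f s n
    (r.2 :: r.1, G.δ r.2 (f r.1 r.2))

/-- The play from `s` in which all players follow `f`. -/
def play (G : MullerGame P S A) (f : List S → S → A) (s : S) (n : ℕ) : S := (G.playState f s n).2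

theorem past_play (G : MullerGame P S A) (f : List S → S → A) (s : S) (n : ℕ) :
    past (G.play f s) n = (G.playState f s n).1 := by
  induction n with
  | zero => rfl
  | succ n ih => rw [past_succ, ih]; rfl

theorem play_succ (G : MullerGame P S A) (f : List S → S → A) (s : S) (n : ℕ) :
    G.play f s (n + 1) = G.δ (G.play f s n) (f (past (G.play f s) n) (G.play f s n)) := by
  rw [past_play]; rfl

theorem followsOn_play (G : MullerGame P S A) (C : Set P) (f : List S → S → A) (s : S) :
    G.FollowsOn C f (G.play f s) := fun n _ => G.play_succ f s n

theorem isPath_play (G : MullerGame P S A) {f : List S → S → A} (hf : G.IsLegalPlan f) (s : S) :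
    G.IsPath (G.play f s) := fun n => ⟨_, hf _ _, (G.play_succ f s n).symm⟩

/-- Two sequences developing in the same way from the same first state are equal. -/
theorem eq_of_step_eq {x y : ℕ → S} {n : ℕ} (h0 : x 0 = y 0)
    (h : ∀ m < n, past x m = past y m → x m = y m → x (m + 1) = y (m + 1)) : ∀ m ≤ n, x m = y m := by
  intro m
  induction m using Nat.strong_induction_on with
  | _ m ih =>
    intro hm
    cases m with
    | zero => exact h0
    | succ m =>
      exact h m (by omega) (past_congr fun j hj => ih j (by omega) (by omega))
        (ih m (by omega) (by omega))

theorem eq_play (G : MullerGame P S A) {f : List S → S → A} {x : ℕ → S}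
    (h : G.FollowsOn Set.univ f x) : x = G.play f (x 0) := by
  funext n
  refine eq_of_step_eq (x := x) (y := G.play f (x 0)) (n := n) rfl (fun m _ h1 h2 => ?_) n le_rfl
  rw [h m trivial, play_succ, h1, h2]

theorem IsPath.exists_actions {G : MullerGame P S A} {x : ℕ → S} (hx : G.IsPath x) :
    ∃ a : ℕ → A, ∀ n, a n ∈ G.Act (G.owner (x n)) ∧ G.δ (x n) (a n) = x (n + 1) := by
  choose a h1 h2 using hx
  exact ⟨a, fun n => ⟨h1 n, h2 n⟩⟩

theorem isPath_of_isRun {G : MullerGame P S A} {ρ : Run S A} (h : G.arena.IsRun ρ) :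
    G.IsPath ρ.st := fun n => ⟨ρ.ac n, (h n).1, (h n).2.symm⟩

open Classical in
/-- Play the actions `a` along the sequence `x`, and default actions after other histories. -/
noncomputable def script (G : MullerGame P S A) (x : ℕ → S) (a : ℕ → A) (h : List S) (s : S) : A :=
  if h = past x h.length ∧ s = x h.length then a h.length else G.defaultAct s

theorem script_past (G : MullerGame P S A) (x : ℕ → S) (a : ℕ → A) (n : ℕ) :
    G.script x a (past x n) (x n) = a n := by
  simp [script, length_past]

theorem isLegalPlan_script (G : MullerGame P S A) {x : ℕ → S} {a : ℕ → A}
    (h : ∀ n, a n ∈ G.Act (G.owner (x n))) : G.IsLegalPlan (G.script x a) := by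
  intro l s
  unfold script
  split_ifs with hl
  · rw [hl.2]; exact h _
  · exact G.defaultAct_mem s

theorem mem_obj {G : MullerGame P S A} {i : P} {ρ : Run S A} : ρ ∈ G.obj i ↔ infSet ρ.st ∈ G.F i :=
  Iff.rfl

theorem exists_winsFrom_iff (G : MullerGame P S A) (i : P) (s : S) :
    (∃ σ : G.arena.Strategy i, G.arena.WinsFrom s σ (G.obj i)) ↔
      G.CoalWins {i} s fun x => infSet x ∈ G.F i := by
  classical
  constructor
  · rintro ⟨σ, hσ⟩
    refine ⟨fun h t => if G.owner t = i then σ.act h t else G.defaultAct t, fun h t => ?_,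
      fun x h0 hx hf => ?_⟩
    · beta_reduce
      split_ifs with ht
      · exact σ.legal h t ht
      · exact G.defaultAct_mem t
    · obtain ⟨a, ha⟩ := hx.exists_actions
      refine hσ ⟨x, fun n => if G.owner (x n) = i then σ.act (past x n) (x n) else a n⟩
        (fun n => ?_) h0 fun n hn => if_pos hn
      by_cases hn : G.owner (x n) = i
      · have h1 := hf n hn
        beta_reduce at h1
        rw [if_pos hn] at h1
        simpa only [hn, if_true] using ⟨σ.legal _ _ hn, h1⟩
      · simpa only [hn, if_false] using ⟨(ha n).1, (ha n).2.symm⟩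
  · rintro ⟨f, hf, hw⟩
    refine ⟨⟨f, fun h t _ => hf h t⟩, fun ρ hρ h0 hc => hw ρ.st h0 (isPath_of_isRun hρ) fun n hn => ?_⟩
    rw [(hρ n).2, hc n hn]
    rfl

theorem forall_outcomes_iff (G : MullerGame P S A) (i : P) (s : S) :
    (∀ σ : G.arena.Profile, ∀ ρ ∈ G.arena.Outcomes s Set.univ σ, ρ ∉ G.obj i) ↔
      ∀ x, x 0 = s → G.IsPath x → infSet x ∉ G.F i := by
  constructor
  · intro h x h0 hx
    obtain ⟨a, ha⟩ := hx.exists_actions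
    refine h (fun j => ⟨G.script x a, fun l t _ => G.isLegalPlan_script (fun n => (ha n).1) l t⟩)
      ⟨x, a⟩ ⟨fun n => ⟨(ha n).1, (ha n).2.symm⟩, h0, fun j _ n _ => (G.script_past x a n).symm⟩
  · rintro h σ ρ ⟨hρ, h0, -⟩
    exact h ρ.st h0 (isPath_of_isRun hρ)

theorem CoalWins.exists_path {G : MullerGame P S A} {C : Set P} {s : S} {Φ : (ℕ → S) → Prop}
    (h : G.CoalWins C s Φ) : ∃ x, x 0 = s ∧ G.IsPath x ∧ Φ x := by
  obtain ⟨f, hf, hw⟩ := h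
  exact ⟨G.play f s, rfl, G.isPath_play hf s,
    hw _ rfl (G.isPath_play hf s) (G.followsOn_play C f s)⟩

theorem coalWins_univ {G : MullerGame P S A} {s : S} {Φ : (ℕ → S) → Prop} :
    G.CoalWins Set.univ s Φ ↔ ∃ x, x 0 = s ∧ G.IsPath x ∧ Φ x := by
  refine ⟨CoalWins.exists_path, ?_⟩
  rintro ⟨x, h0, hx, hΦ⟩
  obtain ⟨a, ha⟩ := hx.exists_actions
  refine ⟨G.script x a, G.isLegalPlan_script fun n => (ha n).1, fun y hy0 hy hf => ?_⟩
  suffices y = x by rwa [this]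
  funext n
  refine eq_of_step_eq (n := n) (hy0.trans h0.symm) (fun m _ h1 h2 => ?_) n le_rfl
  rw [hf m trivial, h1, h2, script_past, (ha m).2]

theorem coalWins_empty {G : MullerGame P S A} {s : S} {Φ : (ℕ → S) → Prop} :
    G.CoalWins ∅ s Φ ↔ ∀ x, x 0 = s → G.IsPath x → Φ x :=
  ⟨fun ⟨_, _, hw⟩ x h0 hx => hw x h0 hx fun _ h => h.elim,
    fun h => ⟨fun _ => G.defaultAct, fun _ => G.defaultAct_mem, fun x h0 hx _ => h x h0 hx⟩⟩

/-- Complementary coalitions cannot win complementary objectives. -/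
theorem CoalWins.not_compl {G : MullerGame P S A} {C : Set P} {s : S} {Φ : (ℕ → S) → Prop}
    (h : G.CoalWins C s Φ) : ¬ G.CoalWins Cᶜ s fun x => ¬ Φ x := by
  classical
  rintro ⟨g, hg, hgw⟩
  obtain ⟨f, hf, hfw⟩ := h
  let e : List S → S → A := fun l t => if G.owner t ∈ C then f l t else g l t
  have he : G.IsLegalPlan e := fun l t => by
    unfold e; split_ifs
    · exact hf l t
    · exact hg l t
  have hp := G.isPath_play he s
  refine hgw _ rfl hp (fun n hn => ?_) (hfw _ rfl hp fun n hn => ?_)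
  · rw [play_succ]; simp only [e]; rw [if_neg hn]
  · rw [play_succ]; simp only [e]; rw [if_pos hn]

/-- Muller games are determined for every coalition and its complement. -/
theorem coalWins_or [Finite S] (G : MullerGame P S A) (C : Set P) (s : S) (F : Set (Set S)) :
    G.CoalWins C s (fun x => infSet x ∈ F) ∨ G.CoalWins Cᶜ s (fun x => infSet x ∉ F) := by
  classical
  obtain ⟨c, hc⟩ := G.exists_isEdgeLabelling
  have key : ∀ (p : Bool) (Φ : (ℕ → S) → Prop) (D : Set P),
      (∀ i, decide (i ∈ C) = p ↔ i ∈ D) →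
      s ∈ GWin (fun t => decide (G.owner t ∈ C)) (fun t u => u ∈ G.succs t) Set.univ p Φ →
      G.CoalWins D s Φ := by
    rintro p Φ D hD ⟨f, hf, hw⟩
    -- In the graph game a move is a target vertex; `c` turns it into an action. The default is used
    -- only where `f` proposes no successor, which can happen only at vertices of the other side.
    refine ⟨fun l t => if f l t ∈ G.succs t then c t (f l t) else G.defaultAct t, fun l t => ?_,
      fun x h0 hx hfol => hw x (fun n => ⟨trivial, hx n⟩) h0 fun n hn => ?_⟩
    · beta_reduce
      split_ifs with ht
      · exact (hc t _ ht).1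
      · exact G.defaultAct_mem t
    · have h1 := hfol n ((hD _).1 hn)
      have h2 := (hf (past x n) (x n) trivial hn).2
      beta_reduce at h1 h2
      rw [if_pos h2, (hc _ _ h2).2] at h1
      exact h1
  refine (muller_determined (fun t => decide (G.owner t ∈ C)) (fun t u => u ∈ G.succs t) F true
    Set.univ (fun t _ => ⟨_, trivial, G.defaultAct t, G.defaultAct_mem t, rfl⟩) s trivial).imp
    (key _ _ _ (by simp)) (key _ _ _ (by simp))

theorem val_eq_one_iff (G : MullerGame P S A) {i : P} {s : S} :
    G.val i s = 1 ↔ G.CoalWins {i} s fun x => infSet x ∈ G.F i := by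
  rw [← exists_winsFrom_iff, val]
  split_ifs <;> simp_all

theorem val_eq_neg_one_iff (G : MullerGame P S A) {i : P} {s : S} :
    G.val i s = -1 ↔ ∀ x, x 0 = s → G.IsPath x → infSet x ∉ G.F i := by
  rw [← forall_outcomes_iff, val]
  split_ifs with h1 h2
  · rw [exists_winsFrom_iff] at h1
    obtain ⟨x, h0, hx, hw⟩ := h1.exists_path
    rw [forall_outcomes_iff]
    simp only [false_iff]
    exact fun h => h x h0 hx hw
  · simpa using h2
  · simpa using h2

theorem nonneg_val_iff (G : MullerGame P S A) {i : P} {s : S} :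
    0 ≤ G.val i s ↔ ∃ x, x 0 = s ∧ G.IsPath x ∧ infSet x ∈ G.F i := by
  have : 0 ≤ G.val i s ↔ ¬ G.val i s = -1 := by cases G.val i s <;> decide
  rw [this, val_eq_neg_one_iff]
  push Not
  rfl

theorem val_eq_zero_iff (G : MullerGame P S A) {i : P} {s : S} :
    G.val i s = 0 ↔ (¬ G.CoalWins {i} s fun x => infSet x ∈ G.F i) ∧
      ∃ x, x 0 = s ∧ G.IsPath x ∧ infSet x ∈ G.F i := by
  rw [← val_eq_one_iff, ← nonneg_val_iff]
  cases G.val i s <;> decide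

end MullerGame


/-! ### Alternating runs -/

section Interleave

variable {X A T : Type*}

theorem frequently_even {Y : Type*} {z : ℕ → X ⊕ Y} {m : ℕ → X} (h0 : ∀ n, z (2 * n) = .inl (m n))
    (h1 : ∀ n, ∃ y, z (2 * n + 1) = .inr y) {Q : X ⊕ Y → Prop} (hQ : ∀ y, ¬ Q (.inr y)) :
    (∃ᶠ j in atTop, Q (z j)) ↔ ∃ᶠ n in atTop, Q (.inl (m n)) := by
  simp only [frequently_atTop]
  constructor
  · intro h N
    obtain ⟨j, hj, hQj⟩ := h (2 * N)
    obtain ⟨n, rfl | rfl⟩ := Nat.even_or_odd' j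
    · exact ⟨n, by omega, h0 n ▸ hQj⟩
    · obtain ⟨y, hy⟩ := h1 n
      exact absurd (hy ▸ hQj) (hQ y)
  · intro h N
    obtain ⟨n, hn, hQn⟩ := h N
    exact ⟨2 * n, by omega, (h0 n).symm ▸ hQn⟩

/-- The run `m 0, (m 0, a 0), m 1, (m 1, a 1), …` with the actions `a 0, u 1, a 1, u 2, …`. -/
def interleave (m : ℕ → X) (a : ℕ → A) (u : ℕ → T) : Run (X ⊕ (X × A)) (A ⊕ T) where
  st j := if j % 2 = 0 then .inl (m (j / 2)) else .inr (m (j / 2), a (j / 2))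
  ac j := if j % 2 = 0 then .inl (a (j / 2)) else .inr (u (j / 2 + 1))

/-- The first `2 * n` states of `interleave m a u`, most recent first. -/
def interleavePast (m : ℕ → X) (a : ℕ → A) : ℕ → List (X ⊕ (X × A))
  | 0 => []
  | n + 1 => .inr (m n, a n) :: .inl (m n) :: interleavePast m a n

variable (m : ℕ → X) (a : ℕ → A) (u : ℕ → T) (n : ℕ)

theorem interleave_st_even : (interleave m a u).st (2 * n) = .inl (m n) := by
  simp [interleave]

theorem interleave_st_odd : (interleave m a u).st (2 * n + 1) = .inr (m n, a n) := by
  simp [interleave, Nat.add_mod, Nat.mul_add_div]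

theorem interleave_ac_even : (interleave m a u).ac (2 * n) = .inl (a n) := by
  simp [interleave]

theorem interleave_ac_odd : (interleave m a u).ac (2 * n + 1) = .inr (u (n + 1)) := by
  simp [interleave, Nat.add_mod, Nat.mul_add_div]

theorem past_interleave : past (interleave m a u).st (2 * n) = interleavePast m a n := by
  induction n with
  | zero => rfl
  | succ n ih =>
    rw [show 2 * (n + 1) = 2 * n + 1 + 1 by ring, past_succ, past_succ, ih, interleave_st_odd,
      interleave_st_even]
    rfl

end Interleave

/-! ### Concrete paths and abstract runs -/

namespace Abstraction

variable {P S A T : Type*} {G : MullerGame P S A}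

theorem α_eq {abs : Abstraction G T} {s : S} {t : T} (h : s ∈ abs.γ t) : abs.α s = t :=
  (abs.partition s).unique (abs.mem_γ_α s) h

theorem mem_γ_iff {abs : Abstraction G T} {s : S} {t : T} : s ∈ abs.γ t ↔ abs.α s = t :=
  ⟨α_eq, fun h => h ▸ abs.mem_γ_α s⟩

theorem Δ_α (abs : Abstraction G T) {s : S} {a : A} (ha : a ∈ G.Act (G.owner s)) :
    abs.Δ (abs.α s) a (abs.α (G.δ s a)) :=
  ⟨by rwa [owner_α], s, abs.mem_γ_α s, _, abs.mem_γ_α _, rfl⟩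

theorem resolve_of_Δ {abs : Abstraction G T} {s : T} {a : A} {t : T} (h : abs.Δ s a t) :
    abs.resolve s a t = t := if_pos h

theorem image_γSet (abs : Abstraction G T) (X : Set S) :
    abs.α '' abs.γSet (abs.α '' X) = abs.α '' X := by
  ext t
  simp only [γSet, Set.mem_image, Set.mem_iUnion, mem_γ_iff]
  constructor
  · rintro ⟨s, ⟨_, ⟨r, hr, rfl⟩, h⟩, rfl⟩
    exact ⟨r, hr, h.symm⟩
  · rintro ⟨s, hs, rfl⟩
    exact ⟨s, ⟨_, ⟨s, hs, rfl⟩, rfl⟩, rfl⟩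

theorem image_mem_Fabs {abs : Abstraction G T} (hobj : abs.CompatibleObjectives) (i : P)
    (X : Set S) : abs.α '' X ∈ abs.Fabs i ↔ X ∈ G.F i :=
  hobj i _ _ (abs.image_γSet X)

/-- Pigeonhole: if the image recurs, then one of the finitely many states in its fibre recurs. -/
theorem frequently_comp_iff [Finite S] {Y : Type*} (g : S → Y) (x : ℕ → S) (y : Y) :
    (∃ᶠ n in atTop, g (x n) = y) ↔ y ∈ g '' infSet x := by
  constructor
  · intro h
    by_contra hcon
    have h1 : ∀ s, ∀ᶠ n in atTop, g s = y → x n ≠ s := by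
      intro s
      by_cases hs : g s = y
      · have : s ∉ infSet x := fun h => hcon ⟨s, h, hs⟩
        simpa [hs, infSet] using this
      · simp [hs]
    exact h ((eventually_all.2 h1).mono fun n hn hy => hn (x n) hy rfl)
  · rintro ⟨s, hs, rfl⟩
    exact Frequently.mono hs fun n hn => hn ▸ rfl

theorem frequently_α_mem_Fabs [Finite S] {abs : Abstraction G T}
    (hobj : abs.CompatibleObjectives) (i : P) (x : ℕ → S) :
    {t | ∃ᶠ n in atTop, abs.α (x n) = t} ∈ abs.Fabs i ↔ infSet x ∈ G.F i := by
  rw [← image_mem_Fabs hobj]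
  simp only [frequently_comp_iff]
  rfl

/-- The abstract run `ρ` runs through the abstractions of the states of `x`. -/
def Traces (abs : Abstraction G T) (ρ : Run (T ⊕ (T × A)) (A ⊕ T)) (x : ℕ → S) : Prop :=
  (∀ n, ρ.st (2 * n) = .inl (abs.α (x n))) ∧ ∀ n, ∃ y, ρ.st (2 * n + 1) = .inr y

theorem Traces.mem_objAbs [Finite S] {abs : Abstraction G T} (hobj : abs.CompatibleObjectives)
    {ρ : Run (T ⊕ (T × A)) (A ⊕ T)} {x : ℕ → S} (h : abs.Traces ρ x) (i : P) :
    ρ ∈ abs.objAbs i ↔ infSet x ∈ G.F i := by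
  rw [← frequently_α_mem_Fabs hobj, objAbs, Set.mem_ofPred_eq]
  have : ∀ t, (∃ᶠ n in atTop, ρ.st n = .inl t) ↔ ∃ᶠ n in atTop, abs.α (x n) = t := by
    intro t
    rw [frequently_even h.1 h.2 (Q := (· = .inl t)) (by simp)]
    simp
  simp only [this]

theorem coalArena_step_state {abs : Abstraction G T} {C : Set P} {ρ : Run (T ⊕ (T × A)) (A ⊕ T)}
    (hρ : (abs.coalArena C).IsRun ρ) {j : ℕ} {t : T} (h : ρ.st j = .inl t) :
    ∃ a ∈ G.Act (abs.owner t), ρ.ac j = .inl a ∧ ρ.st (j + 1) = .inr (t, a) := by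
  obtain ⟨h1, h2⟩ := hρ j
  rw [h] at h1 h2
  obtain ⟨a, ha, hEq⟩ := h1
  rw [← hEq] at h2
  exact ⟨a, ha, hEq.symm, h2⟩

theorem coalArena_step_mid {abs : Abstraction G T} {C : Set P} {ρ : Run (T ⊕ (T × A)) (A ⊕ T)}
    (hρ : (abs.coalArena C).IsRun ρ) {j : ℕ} {t : T} {a : A} (h : ρ.st j = .inr (t, a)) :
    ∃ u, ρ.ac j = .inr u ∧ ρ.st (j + 1) = .inl (abs.resolve t a u) := by
  obtain ⟨h1, h2⟩ := hρ j
  rw [h] at h1 h2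
  obtain ⟨u, hEq⟩ := h1
  rw [← hEq] at h2
  exact ⟨u, hEq.symm, h2⟩

/-- The concrete history (earlier states and current state) from `s` along the actions occurring in
an abstract history. -/
def track (G : MullerGame P S A) (s : S) : List (T ⊕ (T × A)) → List S × S
  | [] => ([], s)
  | .inl _ :: h => track G s h
  | .inr (_, a) :: h => ((track G s h).2 :: (track G s h).1, G.δ (track G s h).2 a)

open Classical in
/-- The coalition resolving the nondeterminism can simulate any concrete plan. -/
noncomputable def simulate (abs : Abstraction G T) (C : Set P) (s : S) (f : List S → S → A)
    (D : Side) : (abs.coalArena C).Strategy D where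
  act
    | h, .inl t => .inl (if f (track G s h).1 (track G s h).2 ∈ G.Act (abs.owner t)
        then f (track G s h).1 (track G s h).2 else (G.Act_nonempty (abs.owner t)).choose)
    | h, .inr (_, a) => .inr (abs.α (G.δ (track G s h).2 a))
  legal h q _ := by
    cases q with
    | inl t =>
      refine ⟨_, ?_, rfl⟩
      split_ifs with h1
      · exact h1
      · exact (G.Act_nonempty _).choose_spec
    | inr q => exact ⟨_, rfl⟩

/-- The side resolving the nondeterminism can keep a hidden concrete play: the actions in the
abstract history determine it from `s`. It answers every action with the abstraction of the true
successor, so the abstract run traces a concrete path following the plan. -/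
theorem mem_winAbs_coal_of_coalWins {abs : Abstraction G T} {C : Set P} {s : S}
    {Φ : (ℕ → S) → Prop} {Ψ : Set (Run (T ⊕ (T × A)) (A ⊕ T))} (h : G.CoalWins C s Φ)
    (hΨ : ∀ ρ x, abs.Traces ρ x → Φ x → ρ ∈ Ψ) : abs.α s ∈ abs.winAbs C .coal Ψ := by
  obtain ⟨f, hf, hw⟩ := h
  refine ⟨abs.simulate C s f, ?_⟩
  rintro ρ ⟨hρ, h0, hc⟩
  replace hc := hc .coal rfl
  let r : ℕ → List S × S := fun n => track G s (past ρ.st (2 * n))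
  have step : ∀ n, ρ.st (2 * n) = .inl (abs.α (r n).2) → ∃ a ∈ G.Act (G.owner (r n).2),
      ρ.st (2 * n + 1) = .inr (abs.α (r n).2, a) ∧ r (n + 1) = ((r n).2 :: (r n).1, G.δ (r n).2 a) ∧
      ρ.st (2 * (n + 1)) = .inl (abs.α (G.δ (r n).2 a)) ∧
      (G.owner (r n).2 ∈ C → a = f (r n).1 (r n).2) := by
    intro n hn
    obtain ⟨a, ha, hac, hst⟩ := coalArena_step_state hρ hn
    rw [owner_α] at ha
    obtain ⟨u, hu, hst'⟩ := coalArena_step_mid hρ hst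
    have hr : track G s (past ρ.st (2 * n + 1)) = r n := by
      rw [past_succ, hn]; rfl
    refine ⟨a, ha, hst, ?_, ?_, fun ho => ?_⟩
    · change track G s (past ρ.st (2 * n + 1 + 1)) = _
      rw [past_succ, hst, track, hr]
    · have h2 := hc (2 * n + 1) (by rw [hst]; rfl)
      rw [hst, hu] at h2
      have h3 : u = abs.α (G.δ (r n).2 a) := by
        simpa [simulate, hr] using h2
      rw [show 2 * (n + 1) = 2 * n + 1 + 1 by ring, hst', h3, resolve_of_Δ (abs.Δ_α ha)]
    · have h2 := hc (2 * n) (by rw [hn]; simp [coalArena, owner_α, ho])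
      rw [hn, hac] at h2
      simp only [simulate, Sum.inl.injEq] at h2
      rw [h2, if_pos]
      rw [owner_α]
      exact hf _ _
  have hst : ∀ n, ρ.st (2 * n) = .inl (abs.α (r n).2) := by
    intro n
    induction n with
    | zero => exact h0
    | succ n ih =>
      obtain ⟨a, ha, -, h2, h3, -⟩ := step n ih
      rw [h3, h2]
  have hpast : ∀ n, past (fun n => (r n).2) n = (r n).1 := by
    intro n
    induction n with
    | zero => rfl
    | succ n ih =>
      obtain ⟨a, ha, -, h2, -⟩ := step n (hst n)
      rw [past_succ, ih, h2]
  refine hΨ ρ (fun n => (r n).2) ⟨hst, fun n => ?_⟩ (hw _ rfl (fun n => ?_) fun n ho => ?_)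
  · obtain ⟨a, ha, h1, -⟩ := step n (hst n)
    exact ⟨_, h1⟩
  · obtain ⟨a, ha, -, h2, -⟩ := step n (hst n)
    exact ⟨a, ha, by rw [h2]⟩
  · obtain ⟨a, ha, -, h2, -, h3⟩ := step n (hst n)
    rw [hpast, h2, h3 ho]

open Classical in
/-- The abstract history of a concrete one for a strategy `τ` of the complement of `C`. -/
noncomputable def coalHist (abs : Abstraction G T) {C : Set P} (c : S → S → A)
    (τ : (abs.coalArena C).Strategy .anti) : List S → S → List (T ⊕ (T × A))
  | [], _ => []
  | p :: ps, s =>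
    let q := coalHist abs c τ ps p
    let b := Sum.elim id (fun _ => G.defaultAct p) (τ.act q (.inl (abs.α p)))
    .inr (abs.α p, if G.owner p ∉ C ∧ G.δ p b = s then b else c p s) :: .inl (abs.α p) :: q

/-- The side that does not resolve the nondeterminism wins against all resolutions, in particular
against the one dictated by a concrete path. Its strategy is applied to the abstraction of the
concrete history. -/
theorem coalWins_of_mem_winAbs_anti {abs : Abstraction G T} {C : Set P} {s : S}
    {Φ : (ℕ → S) → Prop} {Ψ : Set (Run (T ⊕ (T × A)) (A ⊕ T))} (h : abs.α s ∈ abs.winAbs C .anti Ψ)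
    (hΨ : ∀ ρ x, abs.Traces ρ x → ρ ∈ Ψ → Φ x) : G.CoalWins Cᶜ s Φ := by
  classical
  obtain ⟨τ, hτ⟩ := h
  obtain ⟨c, hcl⟩ := G.exists_isEdgeLabelling
  let b : List S → S → A := fun h t =>
    Sum.elim id (fun _ => G.defaultAct t) ((τ .anti).act (abs.coalHist c (τ .anti) h t) (.inl (abs.α t)))
  have hb : ∀ h t, G.owner t ∉ C → b h t ∈ G.Act (G.owner t) ∧
      (τ .anti).act (abs.coalHist c (τ .anti) h t) (.inl (abs.α t)) = .inl (b h t) := by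
    intro h t ht
    obtain ⟨a, ha, hEq⟩ := (τ .anti).legal (abs.coalHist c (τ .anti) h t) (.inl (abs.α t))
      (by simp [coalArena, owner_α, ht])
    rw [owner_α] at ha
    simp only [b, ← hEq, Sum.elim_inl, id]
    exact ⟨ha, trivial⟩
  refine ⟨fun h t => if G.owner t ∉ C then b h t else G.defaultAct t, fun h t => ?_,
    fun x h0 hx hf => ?_⟩
  · beta_reduce
    split_ifs with ht
    · exact G.defaultAct_mem t
    · exact (hb h t ht).1
  -- The actions are rebuilt from the states. Where the path follows the plan at a state outside
  -- `C`, the rebuilt action is the prescribed one, which makes the traced run compatible with the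
  -- abstract strategy.
  let a : ℕ → A := fun n => if G.owner (x n) ∉ C ∧ G.δ (x n) (b (past x n) (x n)) = x (n + 1)
    then b (past x n) (x n) else c (x n) (x (n + 1))
  have ha : ∀ n, a n ∈ G.Act (G.owner (x n)) ∧ G.δ (x n) (a n) = x (n + 1) := by
    intro n
    simp only [a]
    split_ifs with hn
    · exact ⟨(hb _ _ hn.1).1, hn.2⟩
    · exact hcl _ _ (hx n)
  have hhist : ∀ n, abs.coalHist c (τ .anti) (past x n) (x n) =
      interleavePast (fun n => abs.α (x n)) a n := by
    intro n
    induction n with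
    | zero => rfl
    | succ n ih =>
      rw [past_succ, coalHist, interleavePast, ih]
      simp only [a, b, ih]
  refine hΨ (interleave (fun n => abs.α (x n)) a fun n => abs.α (x n)) x
    ⟨interleave_st_even _ _ _, fun n => ⟨_, interleave_st_odd _ _ _ n⟩⟩ (hτ ⟨fun j => ?_, ?_, ?_⟩)
  · obtain ⟨n, rfl | rfl⟩ := Nat.even_or_odd' j
    · rw [interleave_st_odd, interleave_st_even, interleave_ac_even]
      exact ⟨⟨a n, by rw [owner_α]; exact (ha n).1, rfl⟩, rfl⟩
    · rw [show 2 * n + 1 + 1 = 2 * (n + 1) by ring, interleave_st_odd, interleave_st_even,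
        interleave_ac_odd]
      refine ⟨⟨_, rfl⟩, ?_⟩
      have := abs.Δ_α (ha n).1
      rw [(ha n).2] at this
      simp [coalArena, resolve_of_Δ this]
  · rw [← h0]; rfl
  · rintro _ rfl j ho
    obtain ⟨n, rfl | rfl⟩ := Nat.even_or_odd' j
    · rw [interleave_st_even] at ho
      have hn : G.owner (x n) ∉ C := by
        intro hn
        simp [coalArena, owner_α, hn] at ho
      rw [past_interleave, interleave_st_even, interleave_ac_even, ← hhist, (hb _ _ hn).2]
      have h1 := hf n hn
      beta_reduce at h1
      rw [if_pos hn] at h1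
      simp only [a]
      rw [if_pos ⟨hn, h1.symm⟩]
    · rw [interleave_st_odd] at ho
      exact absurd ho (by simp [coalArena])

/-! ### Approximation of the values -/

/-- Determinacy enters only for value `0`: that player `k` cannot win has to become a winning plan
of the other players. -/
theorem α_mem_Vup_val [Finite S] {abs : Abstraction G T} (hobj : abs.CompatibleObjectives) (k : P)
    (s : S) : abs.α s ∈ abs.Vup k (G.val k s) := by
  have pos : ∀ ρ x, abs.Traces ρ x → infSet x ∈ G.F k → ρ ∈ abs.objAbs k :=
    fun ρ x h => (h.mem_objAbs hobj k).2
  have neg : ∀ ρ x, abs.Traces ρ x → infSet x ∉ G.F k → ρ ∈ (abs.objAbs k)ᶜ :=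
    fun ρ x h h1 h2 => h1 ((h.mem_objAbs hobj k).1 h2)
  rcases hv : G.val k s with _ | _ | _
  · obtain ⟨h1, h2⟩ := G.val_eq_zero_iff.1 hv
    exact ⟨mem_winAbs_coal_of_coalWins ((G.coalWins_or {k} s (G.F k)).resolve_left h1) neg,
      mem_winAbs_coal_of_coalWins (MullerGame.coalWins_univ.2 h2) pos⟩
  · exact mem_winAbs_coal_of_coalWins (MullerGame.coalWins_empty.2 (G.val_eq_neg_one_iff.1 hv)) neg
  · exact mem_winAbs_coal_of_coalWins (G.val_eq_one_iff.1 hv) pos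

/-- Unfolding the fixpoint once is all that is needed. The two winning regions pin down the value of
the state; the `cpre` part keeps the value known after the next step. -/
theorem Vlow_zero_subset (abs : Abstraction G T) (k : P) :
    abs.Vlow k 0 ⊆ abs.cpre k (abs.Vlow k 0 ∪ abs.VlowPos k ∪ abs.VlowNeg k) ∩
      (abs.winAbs {k} .anti (abs.objAbs k)ᶜ ∩ abs.winAbs ∅ .anti (abs.objAbs k)) :=
  (abs.zeroOp k).map_gfp.symm.subset

theorem val_of_mem_Vlow [Finite S] {abs : Abstraction G T} (hobj : abs.CompatibleObjectives) {k : P}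
    {s : S} {x : SignType} (h : abs.α s ∈ abs.Vlow k x) : G.val k s = x := by
  have pos : ∀ ρ x, abs.Traces ρ x → ρ ∈ abs.objAbs k → infSet x ∈ G.F k :=
    fun ρ x h => (h.mem_objAbs hobj k).1
  have neg : ∀ ρ x, abs.Traces ρ x → ρ ∈ (abs.objAbs k)ᶜ → infSet x ∉ G.F k :=
    fun ρ x h h1 h2 => h1 ((h.mem_objAbs hobj k).2 h2)
  rcases x with _ | _ | _
  · obtain ⟨-, h1, h2⟩ := abs.Vlow_zero_subset k h
    exact G.val_eq_zero_iff.2 ⟨fun hw => hw.not_compl (coalWins_of_mem_winAbs_anti h1 neg),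
      (coalWins_of_mem_winAbs_anti h2 pos).exists_path⟩
  · have := coalWins_of_mem_winAbs_anti h neg
    rw [Set.compl_univ, MullerGame.coalWins_empty] at this
    exact G.val_eq_neg_one_iff.2 this
  · have := coalWins_of_mem_winAbs_anti h pos
    rw [compl_compl] at this
    exact G.val_eq_one_iff.2 this

theorem mem_H_of_mem_Hlow [Finite S] {abs : Abstraction G T} (hobj : abs.CompatibleObjectives)
    {k : P} {s : S} (h : abs.α s ∈ abs.Hlow k) : s ∈ G.H k := by
  obtain ⟨h0, ho, a, ha, b, hb, -, hd, hsub⟩ := h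
  rw [owner_α] at ho ha hb
  have hnn : ∀ r, abs.α r ∈ abs.Vlow k 0 ∪ abs.Vlow k 1 → 0 ≤ G.val k r := by
    rintro r (hr | hr)
    · exact (val_of_mem_Vlow hobj hr).ge
    · rw [val_of_mem_Vlow hobj hr]; decide
  refine ⟨ho, val_of_mem_Vlow hobj h0, _, ⟨a, ha, rfl⟩, _, ⟨b, hb, rfl⟩, fun hEq => ?_,
    hnn _ (hsub (Or.inl (abs.Δ_α ha))), hnn _ (hsub (Or.inr (abs.Δ_α hb)))⟩
  -- A common concrete successor would have its abstraction in both of the disjoint sets of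
  -- successors.
  refine (hd.subset ⟨abs.Δ_α ha, ?_⟩ : abs.α (G.δ s a) ∈ (∅ : Set T))
  rw [hEq]
  exact abs.Δ_α hb

theorem α_mem_Hup_of_mem_H [Finite S] {abs : Abstraction G T} (hobj : abs.CompatibleObjectives)
    {k : P} {s : S} (h : s ∈ G.H k) : abs.α s ∈ abs.Hup k := by
  obtain ⟨ho, h0, _, ⟨a, ha, rfl⟩, _, ⟨b, hb, rfl⟩, -, hva, hvb⟩ := h
  have hup : ∀ r, 0 ≤ G.val k r → abs.α r ∈ abs.Vup k 0 ∪ abs.Vup k 1 := by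
    intro r hr
    have := α_mem_Vup_val hobj k r
    revert hr this
    rcases G.val k r with _ | _ | _
    · exact fun _ => Or.inl
    · intro h; exact absurd h (by decide)
    · exact fun _ => Or.inr
  refine ⟨?_, by rwa [owner_α], _, hup _ hva, _, hup _ hvb, ⟨a, abs.Δ_α ha⟩, b, abs.Δ_α hb⟩
  have := α_mem_Vup_val hobj k s
  rwa [h0] at this

end Abstraction


/-! ### Values along edges -/

namespace MullerGame

variable {P S A : Type*}

/-- The sequence `s, x 0, x 1, …`. -/
def consSeq (s : S) (x : ℕ → S) : ℕ → S
  | 0 => s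
  | n + 1 => x n

theorem consSeq_shift (s : S) (x : ℕ → S) : (fun n => consSeq s x (1 + n)) = x := by
  funext n
  rw [Nat.add_comm]
  rfl

theorem infSet_consSeq (s : S) (x : ℕ → S) : infSet (consSeq s x) = infSet x := by
  rw [← infSet_shift _ 1, consSeq_shift]

theorem IsPath.shift {G : MullerGame P S A} {x : ℕ → S} (hx : G.IsPath x) (n : ℕ) :
    G.IsPath fun m => x (n + m) := fun m => hx (n + m)

theorem IsPath.consSeq {G : MullerGame P S A} {x : ℕ → S} (hx : G.IsPath x) {s : S}
    (h : x 0 ∈ G.succs s) : G.IsPath (consSeq s x)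
  | 0 => h
  | n + 1 => hx n

theorem nonneg_val_of_succ (G : MullerGame P S A) {i : P} {s t : S} (ht : t ∈ G.succs s)
    (h : 0 ≤ G.val i t) : 0 ≤ G.val i s := by
  obtain ⟨x, rfl, hx, hw⟩ := G.nonneg_val_iff.1 h
  exact G.nonneg_val_iff.2 ⟨consSeq s x, rfl, hx.consSeq ht, by rwa [infSet_consSeq]⟩

theorem val_eq_one_of_succ (G : MullerGame P S A) {i : P} {s t : S} (ho : G.owner s = i)
    (ht : t ∈ G.succs s) (h : G.val i t = 1) : G.val i s = 1 := by
  classical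
  obtain ⟨a, ha, rfl⟩ := ht
  obtain ⟨f, hf, hw⟩ := G.val_eq_one_iff.1 h
  -- Histories are listed most recent first, so `dropLast` forgets the initial state `s` and
  -- restarts the plan at the successor.
  refine G.val_eq_one_iff.2 ⟨fun h r => if h = [] then
    if r = s then a else G.defaultAct r else f h.dropLast r, fun h r => ?_, fun x h0 hx hfol => ?_⟩
  · beta_reduce
    split_ifs with h1 h2
    · exact h2 ▸ ha
    · exact G.defaultAct_mem r
    · exact hf _ _
  · have h1 : x 1 = G.δ s a := by
      have := hfol 0 (by rw [h0]; exact ho)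
      simpa [past, h0] using this
    change infSet x ∈ G.F i
    rw [← infSet_shift x 1]
    refine hw _ h1 (hx.shift 1) fun n hn => ?_
    have h2 := hfol (1 + n) hn
    rw [past_add] at h2
    simp only [past, List.append_eq_nil_iff, List.cons_ne_nil, and_false, if_false,
      List.dropLast_concat] at h2
    exact h2

/-- A player cannot raise the own value by an own move. This is why the inequality in `Elow` already
gives the equality in `E`. -/
theorem val_succ_le (G : MullerGame P S A) {i : P} {s t : S} (ho : G.owner s = i)
    (ht : t ∈ G.succs s) : G.val i t ≤ G.val i s := by
  have h0 := G.nonneg_val_of_succ (i := i) ht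
  have h1 := G.val_eq_one_of_succ ho ht
  revert h0 h1
  cases G.val i s <;> cases G.val i t <;> decide

/-- Actions are not observed, so an action rebuilt from the states may differ from the one played;
both have the same target. -/
theorem mem_E_congr {G : MullerGame P S A} {i : P} {s : S} {a b : A} (h : G.δ s a = G.δ s b) :
    (s, a) ∈ G.E i ↔ (s, b) ∈ G.E i := by
  simp [E, h]

end MullerGame

/-! ### Edges between abstract states of known value -/

namespace Abstraction

variable {P S A T : Type*} {G : MullerGame P S A}

/-- The abstract run starting with the step `t`, `(t, a)` and continuing as `ρ`. -/
def consRun (t : T) (a : A) (u : T) (ρ : Run (T ⊕ (T × A)) (A ⊕ T)) :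
    Run (T ⊕ (T × A)) (A ⊕ T) where
  st
    | 0 => .inl t
    | 1 => .inr (t, a)
    | n + 2 => ρ.st n
  ac
    | 0 => .inl a
    | 1 => .inr u
    | n + 2 => ρ.ac n

theorem past_consRun (t : T) (a : A) (u : T) (ρ : Run (T ⊕ (T × A)) (A ⊕ T)) (n : ℕ) :
    past (consRun t a u ρ).st (n + 2) = past ρ.st n ++ [.inr (t, a), .inl t] := by
  rw [Nat.add_comm, past_add]
  congr 2
  funext j
  rw [Nat.add_comm]
  rfl

theorem consRun_mem_objAbs (abs : Abstraction G T) (k : P) (t : T) (a : A) (u : T)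
    (ρ : Run (T ⊕ (T × A)) (A ⊕ T)) : consRun t a u ρ ∈ abs.objAbs k ↔ ρ ∈ abs.objAbs k := by
  have : ∀ r, (∃ᶠ n in atTop, (consRun t a u ρ).st n = .inl r) ↔ ∃ᶠ n in atTop, ρ.st n = .inl r := by
    intro r
    rw [← frequently_shift _ 2]
    simp only [Nat.add_comm 2]
    rfl
  simp only [objAbs, Set.mem_ofPred_eq, this]

/-- The winning regions of the side that does not resolve the nondeterminism are closed under moves
of the other side. -/
theorem mem_winAbs_anti_of_post {abs : Abstraction G T} {C : Set P} {t u : T} {a : A}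
    {Ψ : Set (Run (T ⊕ (T × A)) (A ⊕ T))} (hΨ : ∀ ρ, consRun t a u ρ ∈ Ψ → ρ ∈ Ψ)
    (h : t ∈ abs.winAbs C .anti Ψ) (ht : abs.owner t ∈ C) (hu : u ∈ abs.post t a) :
    u ∈ abs.winAbs C .anti Ψ := by
  obtain ⟨τ, hτ⟩ := h
  refine ⟨fun D => ⟨fun h q => (τ D).act (h ++ [.inr (t, a), .inl t]) q,
    fun h q hq => (τ D).legal _ q hq⟩, ?_⟩
  rintro ρ ⟨hρ, h0, hc⟩
  refine hΨ ρ (hτ ⟨?_, rfl, ?_⟩)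
  · rintro (_ | _ | n)
    · exact ⟨⟨a, hu.1, rfl⟩, rfl⟩
    · refine ⟨⟨u, rfl⟩, ?_⟩
      change ρ.st 0 = .inl (abs.resolve t a u)
      rw [h0, resolve_of_Δ hu]
    · exact hρ n
  · rintro _ rfl (_ | _ | n) hn
    · exact absurd hn (by simp [coalArena, consRun, ht])
    · exact absurd hn (by simp [coalArena, consRun])
    · rw [past_consRun]
      exact hc _ rfl n hn

theorem mem_VlowAll {abs : Abstraction G T} {k : P} {t : T} :
    t ∈ abs.VlowAll k ↔ ∃ x, t ∈ abs.Vlow k x := Set.mem_iUnion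

/-- For the values `1` and `-1`, the lower sets are winning regions of the side that does not move
here, hence closed under the move. For value `0`, the `cpre` part of the fixpoint provides the
claim. -/
theorem VlowAll_of_post {abs : Abstraction G T} {k : P} {t u : T} {a : A} (h : t ∈ abs.VlowAll k)
    (ht : abs.owner t ≠ k) (hu : u ∈ abs.post t a) : u ∈ abs.VlowAll k := by
  obtain ⟨x, hx⟩ := mem_VlowAll.1 h
  rw [mem_VlowAll]
  rcases x with _ | _ | _
  · rcases (abs.Vlow_zero_subset k hx).1 with h1 | h1
    · exact absurd h1.1 ht
    · rcases h1.2 a hu.1 hu with (h2 | h2) | h2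
      · exact ⟨0, h2⟩
      · exact ⟨1, h2⟩
      · exact ⟨.neg, h2⟩
  · exact ⟨.neg, mem_winAbs_anti_of_post (Ψ := (abs.objAbs k)ᶜ)
      (fun ρ h1 h2 => h1 ((abs.consRun_mem_objAbs _ _ _ _ _).2 h2)) hx trivial hu⟩
  · exact ⟨1, mem_winAbs_anti_of_post
      (fun ρ => (abs.consRun_mem_objAbs _ _ _ _ _).1) hx ht hu⟩

/-- An edge whose action is not flagged for player `k` preserves the value for `k` and leads to an
abstract state of known value. -/
theorem step_of_mem_VlowAll [Finite S] {abs : Abstraction G T} (hobj : abs.CompatibleObjectives)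
    {k : P} {s : S} {a : A} (ha : a ∈ G.Act (G.owner s)) (h : abs.α s ∈ abs.VlowAll k)
    (hE : ¬ (abs.owner (abs.α s) = k ∧ (abs.α s, a) ∉ abs.Elow k)) :
    abs.α (G.δ s a) ∈ abs.VlowAll k ∧ (s, a) ∈ G.E k := by
  by_cases ho : abs.owner (abs.α s) = k
  · have hE' : (abs.α s, a) ∈ abs.Elow k := by_contra fun h1 => hE ⟨ho, h1⟩
    obtain ⟨x, hx, hsub⟩ := (hE'.resolve_right (not_not.2 h)) ho
    have h1 := hsub (abs.Δ_α ha)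
    simp only [Set.mem_iUnion] at h1
    obtain ⟨l, hl, hmem⟩ := h1
    refine ⟨mem_VlowAll.2 ⟨l, hmem⟩, fun ho' => le_antisymm (G.val_succ_le ho' ⟨a, ha, rfl⟩) ?_⟩
    rw [val_of_mem_Vlow hobj hx, val_of_mem_Vlow hobj hmem]
    exact hl
  · exact ⟨VlowAll_of_post h ho (abs.Δ_α ha), fun ho' => absurd ((abs.owner_α s).trans ho') ho⟩

theorem mem_Eup_of_mem_E [Finite S] {abs : Abstraction G T} (hobj : abs.CompatibleObjectives)
    {j : P} {s : S} {a : A} (ha : a ∈ G.Act (G.owner s)) (h : (s, a) ∈ G.E j) :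
    (abs.α s, a) ∈ abs.Eup j := by
  intro ho
  refine ⟨G.val j s, α_mem_Vup_val hobj j s, _, abs.Δ_α ha, ?_⟩
  simp only [Set.mem_iUnion]
  refine ⟨G.val j s, le_rfl, ?_⟩
  have := α_mem_Vup_val hobj j (G.δ s a)
  rwa [h ((abs.owner_α s).symm.trans ho)] at this

/-! ### Runs of the abstract product game -/

/-- Following the concretization of a winning strategy yields a path that is traced by a winning run
of the abstract product game. -/
theorem exists_abstract_run {abs : Abstraction G T} {k : P} {σ : (abs.prodArena k).Strategy .anti}
    (hσ : (abs.prodArena k).WinsFrom (abs.prodArena k).init σ (abs.OmegaLow k)) {c : S → S → A}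
    (hcl : G.IsEdgeLabelling c) {x : ℕ → S} (h0 : x 0 = G.init) (hx : G.IsPath x)
    (hf : G.FollowsOn {k} (abs.concretize k c σ).act x) :
    ∃ (fl : ℕ → Flag) (a : ℕ → A), fl 0 = .zero ∧
      (∀ n, fl (n + 1) = abs.flagStep k (abs.α (x n)) (a n) (fl n)) ∧
      (∀ n, a n ∈ G.Act (G.owner (x n)) ∧ G.δ (x n) (a n) = x (n + 1)) ∧
      interleave (fun n => (abs.α (x n), fl n)) a (fun n => abs.α (x n)) ∈ abs.OmegaLow k := by
  classical
  let fl : ℕ → Flag := fun n => (abs.absHist k c σ (past x n) (x n)).2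
  let b : ℕ → A := fun n => (abs.concretize k c σ).act (past x n) (x n)
  let a : ℕ → A := fun n => if G.owner (x n) = k ∧ G.δ (x n) (b n) = x (n + 1) then b n
    else c (x n) (x (n + 1))
  have ha : ∀ n, a n ∈ G.Act (G.owner (x n)) ∧ G.δ (x n) (a n) = x (n + 1) := by
    intro n
    simp only [a]
    split_ifs with hn
    · exact ⟨(abs.concretize k c σ).legal _ _ hn.1, hn.2⟩
    · exact hcl _ _ (hx n)
  -- Definitional, because `absHist` inserts exactly the action `a n`.
  have hfl : ∀ n, fl (n + 1) = abs.flagStep k (abs.α (x n)) (a n) (fl n) := fun n => rfl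
  have hhist : ∀ n, (abs.absHist k c σ (past x n) (x n)).1 =
      interleavePast (fun n => (abs.α (x n), fl n)) a n := by
    intro n
    induction n with
    | zero => rfl
    | succ n ih => rw [interleavePast, ← ih]; rfl
  refine ⟨fl, a, rfl, hfl, ha, hσ _ (fun j => ?_) ?_ ?_⟩
  · obtain ⟨n, rfl | rfl⟩ := Nat.even_or_odd' j
    · rw [interleave_st_odd, interleave_st_even, interleave_ac_even]
      exact ⟨⟨a n, by rw [owner_α]; exact (ha n).1, rfl⟩, rfl⟩
    · rw [show 2 * n + 1 + 1 = 2 * (n + 1) by ring, interleave_st_odd, interleave_st_even,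
        interleave_ac_odd]
      refine ⟨⟨_, rfl⟩, ?_⟩
      have := abs.Δ_α (ha n).1
      rw [(ha n).2] at this
      simp [prodArena, resolve_of_Δ this, hfl]
  · change Sum.inl (abs.α (x 0), Flag.zero) = _
    rw [h0]
    rfl
  · intro j ho
    obtain ⟨n, rfl | rfl⟩ := Nat.even_or_odd' j
    · rw [interleave_st_even] at ho
      have hn : G.owner (x n) = k := by
        by_contra hn
        simp [prodArena, owner_α, hn] at ho
      rw [past_interleave, interleave_st_even, interleave_ac_even, ← hhist]
      -- The path follows the concretization, so the prescribed action explains the step and is the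
      -- one inserted.
      have h1 : a n = b n := if_pos ⟨hn, (hf n hn).symm⟩
      obtain ⟨d, -, hd⟩ := σ.legal (abs.absHist k c σ (past x n) (x n)).1
        (.inl (abs.α (x n), fl n)) ho
      rw [h1, ← hd]
      simp only [b, concretize]
      rw [show (abs.absHist k c σ (past x n) (x n)).2 = fl n from rfl, ← hd]
      rfl
    · rw [interleave_st_odd] at ho
      exact absurd ho (by simp [prodArena])

section Product

variable {abs : Abstraction G T} {x : ℕ → S} {fl : ℕ → Flag} {a : ℕ → A}

theorem mem_GFabs_interleave {B : Set T} :
    interleave (fun n => (abs.α (x n), fl n)) a (fun n => abs.α (x n)) ∈ GFabs B ↔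
      ∃ᶠ n in atTop, abs.α (x n) ∈ B := by
  refine (frequently_even (interleave_st_even _ _ _) (fun n => ⟨_, interleave_st_odd _ _ _ n⟩)
    (Q := fun q : PState T A => ∃ t ∈ B, ∃ x, q = .inl (t, x)) (by simp)).trans ?_
  simp

theorem mem_GFflag_interleave {f : Flag} :
    interleave (fun n => (abs.α (x n), fl n)) a (fun n => abs.α (x n)) ∈ GFflag f ↔
      ∃ᶠ n in atTop, fl n = f := by
  refine (frequently_even (interleave_st_even _ _ _) (fun n => ⟨_, interleave_st_odd _ _ _ n⟩)
    (Q := fun q : PState T A => ∃ t, q = .inl (t, f)) (by simp)).trans ?_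
  simp

theorem mem_objProd_interleave [Finite S] (hobj : abs.CompatibleObjectives) {i : P} :
    interleave (fun n => (abs.α (x n), fl n)) a (fun n => abs.α (x n)) ∈ abs.objProd i ↔
      infSet x ∈ G.F i := by
  rw [← frequently_α_mem_Fabs hobj, objProd, Set.mem_ofPred_eq]
  have : ∀ t, (∃ᶠ n in atTop, ∃ f, (interleave (fun n => (abs.α (x n), fl n)) a
      (fun n => abs.α (x n))).st n = .inl (t, f)) ↔ ∃ᶠ n in atTop, abs.α (x n) = t := by
    intro t
    rw [frequently_even (interleave_st_even _ _ _) (fun n => ⟨_, interleave_st_odd _ _ _ n⟩)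
      (Q := fun q => ∃ f, q = .inl (t, f)) (by simp)]
    simp
  simp only [this]

/-- `Mlow` has larger sets in its premises and a smaller set of help states in its conclusion. In
`Mup` the inclusions are reversed, as its occurrence on the left of an implication requires. -/
theorem mem_M_of_mem_Mlow [Finite S] (hobj : abs.CompatibleObjectives) {i : P} {ρ : Run S A}
    (h : interleave (fun n => (abs.α (ρ.st n), fl n)) a (fun n => abs.α (ρ.st n)) ∈ abs.Mlow i) :
    ρ ∈ G.M i := by
  obtain ⟨h1, h2⟩ := h
  rw [mem_GFabs_interleave, mem_objProd_interleave hobj] at h1 h2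
  rw [mem_GFabs_interleave] at h2
  have hV : ∀ v n, ρ.st n ∈ G.V i v → abs.α (ρ.st n) ∈ abs.Vup i v := by
    rintro v n rfl
    exact α_mem_Vup_val hobj i _
  exact ⟨fun h => h1 (h.mono (hV 1)), fun h => (h2 (h.mono (hV 0))).imp id fun h' =>
    h'.mono fun n => mem_H_of_mem_Hlow hobj⟩

theorem mem_Mup_of_mem_M [Finite S] (hobj : abs.CompatibleObjectives) {i : P} {ρ : Run S A}
    (h : ρ ∈ G.M i) :
    interleave (fun n => (abs.α (ρ.st n), fl n)) a (fun n => abs.α (ρ.st n)) ∈ abs.Mup i := by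
  obtain ⟨h1, h2⟩ := h
  unfold Mup
  rw [Set.mem_ofPred_eq, mem_GFabs_interleave, mem_objProd_interleave hobj, mem_GFabs_interleave,
    mem_GFabs_interleave]
  exact ⟨fun h => h1 (h.mono fun n => val_of_mem_Vlow hobj),
    fun h => (h2 (h.mono fun n => val_of_mem_Vlow hobj)).imp id fun h' =>
      h'.mono fun n => α_mem_Hup_of_mem_H hobj⟩

end Product

/-- The flags of the product games along a path: the abstract flag is never `⊥`, hence neither is
the concrete one, and the latter is `⊤` when the former is. -/
theorem flag_invariant [Finite S] {abs : Abstraction G T} (hobj : abs.CompatibleObjectives) {k : P}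
    (hinit : abs.α G.init ∈ abs.VlowAll k) {x : ℕ → S} {fl g : ℕ → Flag} {a b : ℕ → A}
    (h0 : x 0 = G.init) (hfl : ∀ n, fl (n + 1) = abs.flagStep k (abs.α (x n)) (a n) (fl n))
    (hg0 : g 0 = .zero) (hg : ∀ n, g (n + 1) = G.flagStep k (x n) (b n) (g n))
    (ha : ∀ n, a n ∈ G.Act (G.owner (x n)) ∧ G.δ (x n) (a n) = x (n + 1))
    (hb : ∀ n, G.δ (x n) (b n) = x (n + 1)) (hbot : ∀ n, fl n ≠ .bot) (hfl0 : fl 0 = .zero) (n : ℕ) :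
    (fl n = .zero → abs.α (x n) ∈ abs.VlowAll k) ∧ g n ≠ .bot ∧ (fl n = .top → g n = .top) := by
  induction n with
  | zero => simp [h0, hinit, hg0, hfl0]
  | succ n ih =>
    obtain ⟨ih1, ih2, ih3⟩ := ih
    have hab : ∀ i, (x n, a n) ∈ G.E i ↔ (x n, b n) ∈ G.E i := fun i =>
      MullerGame.mem_E_congr ((ha n).2.trans (hb n).symm)
    rw [hg n]
    cases hn : fl n with
    | bot => exact absurd hn (hbot n)
    | top =>
      have : fl (n + 1) = .top := by rw [hfl, hn]; rfl
      rw [this, ih3 hn]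
      simp [MullerGame.flagStep]
    | zero =>
      have hne := hbot (n + 1)
      have hstep := hfl n
      rw [hn] at hstep
      have hlow : ¬ (abs.owner (abs.α (x n)) = k ∧ (abs.α (x n), a n) ∉ abs.Elow k) := by
        intro h
        rw [hstep, flagStep, if_pos h] at hne
        exact hne rfl
      rw [flagStep, if_neg hlow] at hstep
      obtain ⟨hV, hE⟩ := step_of_mem_VlowAll hobj (ha n).1 (ih1 hn) hlow
      rw [(ha n).2] at hV
      refine ⟨fun _ => hV, ?_, fun htop => ?_⟩
      · cases hgn : g n with
        | bot => exact absurd hgn ih2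
        | top => simp [MullerGame.flagStep]
        | zero =>
          rw [MullerGame.flagStep, if_neg (not_not.2 ((hab k).1 hE))]
          split_ifs <;> simp
      · cases hgn : g n with
        | bot => exact absurd hgn ih2
        | top => rfl
        | zero =>
          rw [MullerGame.flagStep, if_neg (not_not.2 ((hab k).1 hE)), if_pos]
          -- If the concrete edge preserved the value of every other player, then no `Eup j` would
          -- be left and the abstract flag would stay `0`.
          by_contra hcon
          push Not at hcon
          rw [if_neg] at hstep
          · rw [hstep] at htop
            exact absurd htop (by simp)
          · rintro ⟨j, hj, -, hjE⟩
            exact hjE (mem_Eup_of_mem_E hobj (ha n).1 ((hab j).2 (hcon j hj)))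

theorem map_past {X Y : Type*} (g : X → Y) (x : ℕ → X) (n : ℕ) :
    (past x n).map g = past (fun m => g (x m)) n := by
  induction n with
  | zero => rfl
  | succ n ih => rw [past_succ, past_succ, List.map_cons, ih]

/-- The concretization of a strategy winning the abstract product game wins the product game. -/
theorem concretize_wins [Finite S] {abs : Abstraction G T} (hobj : abs.CompatibleObjectives) {k : P}
    (hinit : abs.α G.init ∈ abs.VlowAll k) {σ : (abs.prodArena k).Strategy .anti}
    (hσ : (abs.prodArena k).WinsFrom (abs.prodArena k).init σ (abs.OmegaLow k)) {c : S → S → A}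
    (hcl : G.IsEdgeLabelling c) :
    (G.prodArena k).WinsFrom (G.prodArena k).init (G.liftStrategy k (abs.concretize k c σ))
      (G.Omega' k) := by
  intro ρ hρ hρ0 hc
  let x : ℕ → S := fun n => (ρ.st n).1
  let g : ℕ → Flag := fun n => (ρ.st n).2
  have hxstep : ∀ n, G.δ (x n) (ρ.ac n) = x (n + 1) := fun n =>
    (congrArg Prod.fst (hρ n).2).symm
  have hg : ∀ n, g (n + 1) = G.flagStep k (x n) (ρ.ac n) (g n) := fun n =>
    congrArg Prod.snd (hρ n).2
  have hx : G.IsPath x := fun n => ⟨ρ.ac n, (hρ n).1, hxstep n⟩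
  have h0 : x 0 = G.init := congrArg Prod.fst hρ0
  have hg0 : g 0 = .zero := congrArg Prod.snd hρ0
  obtain ⟨fl, a, hfl0, hfl, ha, hΩ⟩ := exists_abstract_run hσ hcl h0 hx fun n hn => by
    have h1 := hc n hn
    rw [← hxstep n, h1]
    simp only [MullerGame.liftStrategy, map_past]
    rfl
  have habs : ∀ f, f = .bot ∨ f = .top → ∀ n, fl n = f → ∀ m ≥ n, fl m = f := by
    intro f hf n hn m hm
    induction m, hm using Nat.le_induction with
    | base => exact hn
    | succ m _ ih => rw [hfl, ih]; rcases hf with rfl | rfl <;> rfl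
  -- Both disjuncts of `OmegaLow` visit `0` or `⊤` infinitely often, which the absorbing flag `⊥`
  -- excludes.
  have hbot : ∀ n, fl n ≠ .bot := by
    intro n hn
    have hev : ∀ᶠ m in atTop, fl m = .bot := eventually_atTop.2 ⟨n, habs _ (Or.inl rfl) n hn⟩
    rcases hΩ with ⟨h1, -⟩ | ⟨h1, -⟩ <;> rw [mem_GFflag_interleave] at h1 <;>
      obtain ⟨m, h2, h3⟩ := (h1.and_eventually hev).exists <;> simp [h2] at h3
  have hinv := flag_invariant hobj hinit h0 hfl hg0 hg ha hxstep hbot hfl0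
  have hM : MullerGame.proj ρ ∈ G.M k := by
    refine mem_M_of_mem_Mlow hobj (fl := fl) (a := a) ?_
    rcases hΩ with ⟨-, h1, -⟩ | ⟨-, h1⟩ <;> exact h1
  -- The concrete flag may reach `⊤` although the abstract one stays `0`. This is harmless, since `M
  -- k` holds in either case and suffices once the concrete flag is `⊤`.
  by_cases htop : ∃ n, g n = .top
  · obtain ⟨n, hn⟩ := htop
    refine Or.inr ⟨Eventually.frequently (eventually_atTop.2 ⟨n, fun m hm => ?_⟩), hM⟩
    change g m = .top
    induction m, hm using Nat.le_induction with
    | base => exact hn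
    | succ m _ ih => rw [hg, ih]; rfl
  · push Not at htop
    have hzero : ∀ n, g n = .zero := by
      intro n
      cases h : g n with
      | bot => exact absurd h (hinv n).2.1
      | top => exact absurd h (htop n)
      | zero => rfl
    refine Or.inl ⟨Eventually.frequently (Eventually.of_forall hzero), hM, fun hMj => ?_⟩
    rcases hΩ with ⟨-, -, h1⟩ | ⟨h1, -⟩
    · exact (mem_objProd_interleave hobj).1 (h1 fun j hj => mem_Mup_of_mem_M hobj (hMj j hj))
    · obtain ⟨n, hn⟩ := (mem_GFflag_interleave.1 h1).exists
      exact absurd ((hinv n).2.2 hn) (htop n)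

end Abstraction


namespace MullerGame

variable {P S A : Type*} {G : MullerGame P S A} {i : P}

/-! ### Outcomes of strategy profiles -/

/-- The plan in which every player follows the own strategy. -/
def joint (σ : G.arena.Profile) (h : List S) (s : S) : A := (σ (G.owner s)).act h s

theorem isLegalPlan_joint (σ : G.arena.Profile) : G.IsLegalPlan (joint σ) :=
  fun h s => (σ (G.owner s)).legal h s rfl

theorem models_iff (σ : G.arena.Profile) :
    G.arena.Models σ (G.obj i) ↔ infSet (G.play (joint σ) G.init) ∈ G.F i := by
  constructor
  · intro h
    refine h (a := ⟨G.play (joint σ) G.init, fun n => joint σ (past (G.play (joint σ) G.init) n)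
      (G.play (joint σ) G.init n)⟩) ⟨fun n => ⟨isLegalPlan_joint σ _ _, G.play_succ _ _ n⟩, rfl, ?_⟩
    rintro j - n rfl
    rfl
  · rintro h ρ ⟨hρ, h0, hc⟩
    have : ρ.st = G.play (joint σ) (ρ.st 0) := by
      refine G.eq_play fun n _ => ?_
      rw [(hρ n).2, hc _ trivial n rfl]
      rfl
    rw [mem_obj, this, h0]
    exact h

theorem joint_subst_of_eq (σ : G.arena.Strategy i) (τ : G.arena.Profile) {h : List S} {s : S}
    (hs : G.owner s = i) : joint (G.arena.subst σ τ) h s = σ.act h s := by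
  subst hs
  simp [joint, Arena.subst]

theorem joint_subst_of_ne (σ : G.arena.Strategy i) (τ : G.arena.Profile) {h : List S} {s : S}
    (hs : G.owner s ≠ i) : joint (G.arena.subst σ τ) h s = joint τ h s := by
  classical
  simp only [joint, Arena.subst]
  rw [Function.update_of_ne hs]

/-- The outcome of `σ` against the profile `τ` of the other players. -/
noncomputable def outcome (σ : G.arena.Strategy i) (τ : G.arena.Profile) : ℕ → S :=
  G.play (joint (G.arena.subst σ τ)) G.init

theorem models_subst_iff (σ : G.arena.Strategy i) (τ : G.arena.Profile) :
    G.arena.Models (G.arena.subst σ τ) (G.obj i) ↔ infSet (outcome σ τ) ∈ G.F i :=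
  models_iff _

theorem isPath_outcome (σ : G.arena.Strategy i) (τ : G.arena.Profile) : G.IsPath (outcome σ τ) :=
  G.isPath_play (isLegalPlan_joint _) _

theorem outcome_succ_of_eq (σ : G.arena.Strategy i) (τ : G.arena.Profile) {n : ℕ}
    (h : G.owner (outcome σ τ n) = i) : outcome σ τ (n + 1) =
      G.δ (outcome σ τ n) (σ.act (past (outcome σ τ) n) (outcome σ τ n)) := by
  rw [← joint_subst_of_eq σ τ h]
  exact G.play_succ _ _ n

theorem outcome_succ_of_ne (σ : G.arena.Strategy i) (τ : G.arena.Profile) {n : ℕ}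
    (h : G.owner (outcome σ τ n) ≠ i) : outcome σ τ (n + 1) =
      G.δ (outcome σ τ n) (joint τ (past (outcome σ τ) n) (outcome σ τ n)) := by
  rw [← joint_subst_of_ne σ τ h]
  exact G.play_succ _ _ n

/-- A sequence agrees with the outcome as long as it develops according to the strategies. -/
theorem outcome_eq_of_le {σ : G.arena.Strategy i} {τ : G.arena.Profile} {y : ℕ → S} {n : ℕ}
    (h0 : y 0 = G.init)
    (h1 : ∀ m < n, G.owner (y m) = i → y (m + 1) = G.δ (y m) (σ.act (past y m) (y m)))
    (h2 : ∀ m < n, G.owner (y m) ≠ i → y (m + 1) = G.δ (y m) (joint τ (past y m) (y m))) :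
    ∀ m ≤ n, outcome σ τ m = y m := by
  refine eq_of_step_eq h0.symm fun m hm hp hs => ?_
  by_cases ho : G.owner (y m) = i
  · rw [h1 m hm ho, outcome_succ_of_eq _ _ (hs ▸ ho), hp, hs]
  · rw [h2 m hm ho, outcome_succ_of_ne _ _ (hs ▸ ho), hp, hs]

theorem outcome_eq {σ : G.arena.Strategy i} {τ : G.arena.Profile} {y : ℕ → S} (h0 : y 0 = G.init)
    (h1 : ∀ m, G.owner (y m) = i → y (m + 1) = G.δ (y m) (σ.act (past y m) (y m)))
    (h2 : ∀ m, G.owner (y m) ≠ i → y (m + 1) = G.δ (y m) (joint τ (past y m) (y m))) :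
    outcome σ τ = y :=
  funext fun n => outcome_eq_of_le (n := n) h0 (fun m _ => h1 m) (fun m _ => h2 m) n le_rfl

/-- All players follow the plan `f`. -/
def planProfile {f : List S → S → A} (hf : G.IsLegalPlan f) : G.arena.Profile :=
  fun _ => ⟨f, fun h s _ => hf h s⟩

theorem joint_planProfile {f : List S → S → A} (hf : G.IsLegalPlan f) :
    joint (planProfile hf) = f := rfl

/-! ### Strategies after a history -/

/-- `y` is a path extending the history `l, s` whose moves from there on follow `σ`. -/
def Continues (σ : G.arena.Strategy i) (l : List S) (s : S) (y : ℕ → S) : Prop :=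
  G.IsPath y ∧ past y l.length = l ∧ y l.length = s ∧
    ∀ m ≥ l.length, G.owner (y m) = i → y (m + 1) = G.δ (y m) (σ.act (past y m) (y m))

/-- The strategy is read on full histories, and the given history need not be compatible with it. -/
def WinsAfter (σ : G.arena.Strategy i) (l : List S) (s : S) : Prop :=
  ∀ y, Continues σ l s y → infSet y ∈ G.F i

def CanWinAfter (σ : G.arena.Strategy i) (l : List S) (s : S) : Prop :=
  ∃ y, Continues σ l s y ∧ infSet y ∈ G.F i

/-- After the history `l, s`, the strategy achieves the value of the state `s`. -/
def AchievesVal (σ : G.arena.Strategy i) (l : List S) (s : S) : Prop :=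
  (G.val i s = 1 → WinsAfter σ l s) ∧ (G.val i s = 0 → CanWinAfter σ l s)

theorem continues_past_iff {σ : G.arena.Strategy i} {x y : ℕ → S} {n : ℕ} :
    Continues σ (past x n) (x n) y ↔ G.IsPath y ∧ (∀ m ≤ n, y m = x m) ∧
      ∀ m ≥ n, G.owner (y m) = i → y (m + 1) = G.δ (y m) (σ.act (past y m) (y m)) := by
  rw [Continues, length_past]
  refine and_congr_right fun _ => ?_
  rw [← and_assoc]
  refine and_congr_left fun _ => ⟨fun h m hm => ?_, fun h => ⟨past_congr fun m hm => h m hm.le,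
    h n le_rfl⟩⟩
  rcases hm.lt_or_eq with hm | rfl
  · exact eq_of_past_eq h.1 m hm
  · exact h.2

/-- The first `n` elements of `x`, followed by `z`. -/
def splice (x : ℕ → S) (n : ℕ) (z : ℕ → S) (m : ℕ) : S := if m < n then x m else z (m - n)

theorem splice_add (x : ℕ → S) (n : ℕ) (z : ℕ → S) (m : ℕ) : splice x n z (n + m) = z m := by
  simp [splice]

theorem splice_of_le {x : ℕ → S} {n : ℕ} {z : ℕ → S} (h : z 0 = x n) {m : ℕ} (hm : m ≤ n) :
    splice x n z m = x m := by
  rcases hm.lt_or_eq with hm | rfl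
  · simp [splice, hm]
  · simpa [splice] using h

theorem past_splice (x : ℕ → S) (n : ℕ) (z : ℕ → S) (m : ℕ) :
    past (splice x n z) (n + m) = past z m ++ past x n := by
  rw [past_add]
  congr 1
  · simp only [splice_add]
  · exact past_congr fun j hj => by simp [splice, hj]

theorem infSet_splice (x : ℕ → S) (n : ℕ) (z : ℕ → S) : infSet (splice x n z) = infSet z := by
  rw [← infSet_shift _ n]
  simp only [splice_add]

theorem IsPath.splice {x z : ℕ → S} (hx : G.IsPath x) (hz : G.IsPath z) {n : ℕ} (h : z 0 = x n) :
    G.IsPath (splice x n z) := by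
  intro m
  rcases lt_or_ge m n with hm | hm
  · rw [splice_of_le h hm.le, splice_of_le h hm]
    exact hx m
  · obtain ⟨j, rfl⟩ := Nat.exists_eq_add_of_le hm
    rw [splice_add, Nat.add_assoc, splice_add]
    exact hz j

theorem val_eq_one_of_strategy {s : S} (σ : G.arena.Strategy i)
    (h : ∀ x, x 0 = s → G.IsPath x → G.FollowsOn {i} σ.act x → infSet x ∈ G.F i) :
    G.val i s = 1 := by
  rw [val_eq_one_iff, ← exists_winsFrom_iff]
  refine ⟨σ, fun ρ hρ h0 hc => h ρ.st h0 (isPath_of_isRun hρ) fun n hn => ?_⟩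
  rw [(hρ n).2, hc n hn]
  rfl

theorem val_eq_one_of_winsAfter {σ : G.arena.Strategy i} {x : ℕ → S} (hx : G.IsPath x) {n : ℕ}
    (h : WinsAfter σ (past x n) (x n)) : G.val i (x n) = 1 := by
  refine val_eq_one_of_strategy ⟨fun l t => σ.act (l ++ past x n) t, fun l t => σ.legal _ t⟩
    fun z h0 hz hf => ?_
  rw [← infSet_splice x n z]
  refine h _ (continues_past_iff.2 ⟨hx.splice hz h0, fun m => splice_of_le h0, fun m hm ho => ?_⟩)
  obtain ⟨j, rfl⟩ := Nat.exists_eq_add_of_le hm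
  rw [splice_add] at ho
  rw [past_splice, splice_add, Nat.add_assoc, splice_add]
  exact hf j ho

theorem nonneg_val_of_path {x : ℕ → S} (hx : G.IsPath x) (hw : infSet x ∈ G.F i) (n : ℕ) :
    0 ≤ G.val i (x n) :=
  G.nonneg_val_iff.2 ⟨_, rfl, hx.shift n, by rwa [infSet_shift]⟩

theorem exists_continues (σ : G.arena.Strategy i) {x : ℕ → S} (hx : G.IsPath x) (n : ℕ) :
    ∃ y, Continues σ (past x n) (x n) y := by
  classical
  let f : List S → S → A := fun l t =>
    if G.owner t = i then σ.act (l ++ past x n) t else G.defaultAct t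
  have hf : G.IsLegalPlan f := by
    intro l t
    unfold f
    split_ifs with ht
    · exact σ.legal _ _ ht
    · exact G.defaultAct_mem t
  have h0 : G.play f (x n) 0 = x n := rfl
  refine ⟨splice x n (G.play f (x n)), continues_past_iff.2 ⟨hx.splice (G.isPath_play hf _) h0,
    fun m => splice_of_le h0, fun m hm ho => ?_⟩⟩
  obtain ⟨j, rfl⟩ := Nat.exists_eq_add_of_le hm
  rw [splice_add] at ho
  rw [past_splice, splice_add, Nat.add_assoc, splice_add, play_succ]
  simp only [f]
  rw [if_pos ho]

theorem WinsAfter.achievesVal {σ : G.arena.Strategy i} {x : ℕ → S} (hx : G.IsPath x) {n : ℕ}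
    (h : WinsAfter σ (past x n) (x n)) : AchievesVal σ (past x n) (x n) := by
  obtain ⟨y, hy⟩ := exists_continues σ hx n
  exact ⟨fun _ => h, fun _ => ⟨y, hy, h y hy⟩⟩

/-- After every history, the value of the current state is achieved by some strategy. -/
theorem exists_achievesVal (i : P) {x : ℕ → S} (hx : G.IsPath x) (n : ℕ) :
    ∃ σ : G.arena.Strategy i, AchievesVal σ (past x n) (x n) := by
  by_cases h1 : G.val i (x n) = 1
  -- The oldest `n` entries stand at the end of the list; removing them restarts the plan at
  -- position `n`.
  · obtain ⟨f, hf, hw⟩ := G.val_eq_one_iff.1 h1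
    refine ⟨⟨fun l t => f (l.take (l.length - n)) t, fun l t _ => hf _ t⟩,
      WinsAfter.achievesVal hx fun y hy => ?_⟩
    obtain ⟨hy, heq, hfol⟩ := continues_past_iff.1 hy
    rw [← infSet_shift y n]
    refine hw _ (heq n le_rfl) (hy.shift n) fun m ho => ?_
    have h2 := hfol (n + m) (by omega) ho
    rw [past_add] at h2
    simpa [length_past, Nat.add_assoc] using h2
  by_cases h0 : G.val i (x n) = 0
  -- For value `0` a single winning continuation is enough, so its actions are simply played by
  -- rote.
  · obtain ⟨-, z, hz0, hz, hw⟩ := G.val_eq_zero_iff.1 h0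
    have hy := hx.splice hz hz0
    obtain ⟨a, ha⟩ := hy.exists_actions
    refine ⟨⟨G.script (splice x n z) a, fun l t _ => G.isLegalPlan_script (fun n => (ha n).1) l t⟩,
      fun h => absurd h h1, fun _ => ⟨splice x n z, continues_past_iff.2 ⟨hy,
        fun m => splice_of_le hz0, fun m _ _ => ?_⟩, by rwa [infSet_splice]⟩⟩
    simp only [script_past]
    exact (ha m).2.symm
  · exact ⟨⟨fun _ => G.defaultAct, fun _ t _ => G.defaultAct_mem t⟩, fun h => absurd h h1,
      fun h => absurd h h0⟩

/-! ### Strategies achieving the value everywhere are admissible -/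

/-- Suppose `σ'` dominates `σ`, and take a profile where only `σ'` wins. The outcomes split at a
state of player `i`, whose value is not `1` since `σ` loses and not `-1` since `σ'` wins. So it is
`0`: `σ` has a winning continuation and `σ'` a losing one, and one profile of the others realizes
both, contradicting domination. -/
theorem mem_Adm_of_achievesVal {σ : G.arena.Strategy i}
    (h : ∀ x, x 0 = G.init → G.IsPath x → G.FollowsOn {i} σ.act x → ∀ n,
      AchievesVal σ (past x n) (x n)) : σ ∈ G.arena.Adm G.obj i := by
  classical
  rintro ⟨σ', hdom, τ, hτ', hτ⟩
  rw [models_subst_iff] at hτ hτ'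
  set x := outcome σ τ with hxdef
  set x' := outcome σ' τ with hx'def
  have hx : G.IsPath x := isPath_outcome σ τ
  have hx' : G.IsPath x' := isPath_outcome σ' τ
  have hx0 : x 0 = G.init := rfl
  have hxf : G.FollowsOn {i} σ.act x := fun n hn => outcome_succ_of_eq σ τ hn
  have hne : ∃ n, x n ≠ x' n := by
    by_contra hcon
    push Not at hcon
    exact hτ (by rwa [funext hcon])
  obtain ⟨N, hN⟩ : ∃ N, Nat.find hne = N + 1 :=
    Nat.exists_eq_succ_of_ne_zero fun h0 => Nat.find_spec hne (by rw [h0]; rfl)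
  have hagree : ∀ m ≤ N, x m = x' m := fun m hm =>
    by_contra fun hmn => Nat.find_min hne (by omega) hmn
  have hdiff : x (N + 1) ≠ x' (N + 1) := hN ▸ Nat.find_spec hne
  have hpast : past x N = past x' N := past_congr fun m hm => hagree m hm.le
  have ho : G.owner (x N) = i := by
    by_contra ho
    refine hdiff ?_
    rw [hxdef, hx'def, outcome_succ_of_ne σ τ ho,
      outcome_succ_of_ne σ' τ (by rw [← hx'def, ← hagree N le_rfl]; exact ho), ← hxdef, ← hx'def,
      hpast, hagree N le_rfl]
  have hgood := h x hx0 hx hxf N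
  have hself : Continues σ (past x N) (x N) x :=
    continues_past_iff.2 ⟨hx, fun _ _ => rfl, fun m _ hm => hxf m hm⟩
  have hv1 : G.val i (x N) ≠ 1 := fun hv => hτ (hgood.1 hv x hself)
  have hv0 : G.val i (x N) = 0 := by
    have := nonneg_val_of_path hx' hτ' N
    rw [← hagree N le_rfl] at this
    revert hv1 this
    cases G.val i (x N) <;> decide
  obtain ⟨y, hy, hyw⟩ := hgood.2 hv0
  have hnot : ¬ WinsAfter σ' (past x N) (x N) := fun hw => hv1 (val_eq_one_of_winsAfter hx hw)
  unfold WinsAfter at hnot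
  push Not at hnot
  obtain ⟨z, hz, hzl⟩ := hnot
  obtain ⟨hyp, hyx, hyf⟩ := continues_past_iff.1 hy
  obtain ⟨hzp, hzx, hzf⟩ := continues_past_iff.1 hz
  have hyf' : ∀ m, G.owner (y m) = i → y (m + 1) = G.δ (y m) (σ.act (past y m) (y m)) := by
    intro m hm
    rcases lt_or_ge m N with hmN | hmN
    · rw [past_congr fun j hj => hyx j (by omega), hyx m hmN.le, hyx (m + 1) hmN]
      exact hxf m (by rw [← hyx m hmN.le]; exact hm)
    · exact hyf m hmN hm
  have hzf' : ∀ m, G.owner (z m) = i → z (m + 1) = G.δ (z m) (σ'.act (past z m) (z m)) := by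
    intro m hm
    rcases lt_or_ge m N with hmN | hmN
    · have hzx' : ∀ j ≤ N, z j = x' j := fun j hj => (hzx j hj).trans (hagree j hj)
      rw [past_congr fun j hj => hzx' j (by omega), hzx' m hmN.le, hzx' (m + 1) hmN]
      exact outcome_succ_of_eq σ' τ (by rw [← hx'def, ← hzx' m hmN.le]; exact hm)
    · exact hzf m hmN hm
  -- The two continuations separate at once by a move of player `i`. The other players can therefore
  -- tell them apart from then on.
  have hyz : y (N + 1) ≠ z (N + 1) := by
    rw [hyf' N (by rw [hyx N le_rfl]; exact ho), hzf' N (by rw [hzx N le_rfl]; exact ho),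
      past_congr fun j hj => hyx j hj.le, past_congr fun j hj => hzx j hj.le, hyx N le_rfl,
      hzx N le_rfl, ← hxf N ho]
    have h3 := outcome_succ_of_eq σ' τ (n := N) (by rw [← hx'def, ← hagree N le_rfl]; exact ho)
    rw [← hx'def, ← hpast, ← hagree N le_rfl] at h3
    rw [← h3]
    exact hdiff
  obtain ⟨a, ha⟩ := hyp.exists_actions
  obtain ⟨b, hb⟩ := hzp.exists_actions
  let e : List S → S → A := fun l t =>
    if l = past y l.length ∧ t = y l.length then a l.length else G.script z b l t
  have he : G.IsLegalPlan e := by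
    intro l t
    unfold e
    split_ifs with hl
    · rw [hl.2]; exact (ha _).1
    · exact G.isLegalPlan_script (fun n => (hb n).1) l t
  have hyout : outcome σ (planProfile he) = y := by
    refine outcome_eq ((hyx 0 (by omega)).trans hx0) hyf' fun m _ => ?_
    rw [joint_planProfile]
    simp only [e, length_past, and_self, if_true]
    exact (ha m).2.symm
  have hzout : outcome σ' (planProfile he) = z := by
    refine outcome_eq ((hzx 0 (by omega)).trans hx0) hzf' fun m hm => ?_
    rw [joint_planProfile]
    simp only [e, length_past]
    -- At a state of another player, the histories of `z` and `y` can coincide only before the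
    -- split, where both paths still equal `x`.
    split_ifs with hc
    · have hmN : m < N := by
        by_contra hge
        rcases Nat.lt_or_ge N m with hlt | hle
        · rcases Nat.lt_or_ge (N + 1) m with h4 | h4
          · exact hyz (eq_of_past_eq hc.1 (N + 1) h4).symm
          · obtain rfl : m = N + 1 := by omega
            exact hyz hc.2.symm
        · obtain rfl : m = N := by omega
          exact hm (by rw [hzx m le_rfl]; exact ho)
      rw [hc.2, (ha m).2, hyx _ hmN, hzx _ hmN]
    · rw [script_past, (hb m).2]
  have := hdom (planProfile he)
  rw [models_subst_iff, models_subst_iff, hyout, hzout] at this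
  exact hzl (this hyw)

end MullerGame


namespace MullerGame

variable {P S A : Type*} {G : MullerGame P S A} {i : P}

/-! ### Admissible strategies achieve the value -/

/-- Histories are listed most recent first, so to have passed through a history is to have it as a
suffix. The index `n + 1` includes the state at position `n`. -/
theorem past_suffix_iff {x y : ℕ → S} {n m : ℕ} :
    past x (n + 1) <:+ y m :: past y m ↔ n ≤ m ∧ ∀ j ≤ n, y j = x j := by
  rw [← past_succ]
  constructor
  · intro h
    have hle : n ≤ m := by
      have := h.length_le
      rw [length_past, length_past] at this
      omega
    obtain ⟨d, rfl⟩ := Nat.exists_eq_add_of_le hle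
    rw [show n + d + 1 = n + 1 + d by omega, past_add y] at h
    have h2 : past y (n + 1) <:+ past (fun j => y (n + 1 + j)) d ++ past y (n + 1) :=
      List.suffix_append _ _
    have h3 : past x (n + 1) = past y (n + 1) :=
      (List.suffix_of_suffix_length_le h h2 (by simp [length_past])).eq_of_length
        (by simp [length_past])
    exact ⟨hle, fun j hj => (eq_of_past_eq h3 j (by omega)).symm⟩
  · rintro ⟨hle, h⟩
    obtain ⟨d, rfl⟩ := Nat.exists_eq_add_of_le hle
    rw [show n + d + 1 = n + 1 + d by omega, past_add y,
      past_congr (x := x) (y := y) fun j hj => (h j (by omega)).symm]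
    exact List.suffix_append _ _

open Classical in
/-- Follow `σ`, but switch to `σ'` after the history `l`. -/
noncomputable def switch (σ σ' : G.arena.Strategy i) (l : List S) : G.arena.Strategy i where
  act h s := if l <:+ s :: h then σ'.act h s else σ.act h s
  legal h s hs := by
    split_ifs
    · exact σ'.legal h s hs
    · exact σ.legal h s hs

theorem switch_act_of_agree (σ σ' : G.arena.Strategy i) {x y : ℕ → S} {n m : ℕ} (hm : n ≤ m)
    (h : ∀ j ≤ n, y j = x j) :
    (switch σ σ' (past x (n + 1))).act (past y m) (y m) = σ'.act (past y m) (y m) :=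
  if_pos (past_suffix_iff.2 ⟨hm, h⟩)

theorem switch_act_of_not_agree (σ σ' : G.arena.Strategy i) {x y : ℕ → S} {n m : ℕ}
    (h : ¬ (n ≤ m ∧ ∀ j ≤ n, y j = x j)) :
    (switch σ σ' (past x (n + 1))).act (past y m) (y m) = σ.act (past y m) (y m) :=
  if_neg fun hc => h (past_suffix_iff.1 hc)

/-- Otherwise, switching after the history to a strategy that achieves the value would dominate `σ`.
For value `1` the switch wins everywhere after the history, while `σ` loses somewhere. For value
`0`, `σ` has nothing to lose there, while the switch wins once. -/
theorem achievesVal_of_mem_Adm {σ : G.arena.Strategy i} (hσ : σ ∈ G.arena.Adm G.obj i) {x : ℕ → S}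
    (hx0 : x 0 = G.init) (hx : G.IsPath x) (hf : G.FollowsOn {i} σ.act x) (n : ℕ) :
    AchievesVal σ (past x n) (x n) := by
  by_contra hbad
  obtain ⟨σ'', hgood⟩ := exists_achievesVal i hx n
  refine hσ ⟨switch σ σ'' (past x (n + 1)), ?_⟩
  set σ' := switch σ σ'' (past x (n + 1)) with hσ'
  -- outcomes through the history, before and after the switch
  have hcont : ∀ τ, (∀ m ≤ n, outcome σ τ m = x m) →
      Continues σ (past x n) (x n) (outcome σ τ) := fun τ h =>
    continues_past_iff.2 ⟨isPath_outcome σ τ, h, fun m _ ho => outcome_succ_of_eq σ τ ho⟩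
  have hagree : ∀ τ, (∀ m ≤ n, outcome σ τ m = x m) → ∀ m ≤ n, outcome σ' τ m = x m := by
    intro τ h m hm
    rw [← h m hm]
    refine outcome_eq_of_le (n := n) rfl (fun j hj ho => ?_) (fun j _ ho =>
      outcome_succ_of_ne σ τ ho) m hm
    rw [hσ', switch_act_of_not_agree _ _ fun hc => absurd hc.1 (by omega)]
    exact outcome_succ_of_eq σ τ ho
  have hcont' : ∀ τ, (∀ m ≤ n, outcome σ τ m = x m) →
      Continues σ'' (past x n) (x n) (outcome σ' τ) := fun τ h =>
    continues_past_iff.2 ⟨isPath_outcome σ' τ, hagree τ h, fun m hm ho => by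
      rw [outcome_succ_of_eq σ' τ ho, hσ', switch_act_of_agree _ _ hm (hagree τ h)]⟩
  have hscript : ∀ y (a : ℕ → A), (∀ m ≤ n, y m = x m) → ∀ hl : G.IsLegalPlan (G.script y a),
      (∀ m, G.δ (y m) (a m) = y (m + 1)) → ∀ m ≤ n, outcome σ (planProfile hl) m = x m := by
    intro y a hyx hl ha m hm
    rw [← hyx m hm]
    refine outcome_eq_of_le (n := n) ((hyx 0 (by omega)).trans hx0) (fun j hj ho => ?_)
      (fun j _ _ => ?_) m hm
    · rw [past_congr fun l hl => hyx l (by omega), hyx j hj.le, hyx (j + 1) hj]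
      exact hf j (by rw [← hyx j hj.le]; exact ho)
    · rw [joint_planProfile, script_past, ha]
  by_cases h1 : G.val i (x n) = 1
  · have hnot : ¬ WinsAfter σ (past x n) (x n) := fun hw => hbad (hw.achievesVal hx)
    refine ⟨fun τ => ?_, ?_⟩
    · rw [models_subst_iff, models_subst_iff]
      intro hw
      by_cases hτ : ∀ m ≤ n, outcome σ τ m = x m
      · exact hgood.1 h1 _ (hcont' τ hτ)
      · suffices outcome σ' τ = outcome σ τ by rwa [this]
        refine outcome_eq rfl (fun m ho => ?_) fun m ho => outcome_succ_of_ne σ τ ho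
        rw [hσ', switch_act_of_not_agree _ _ fun hc => hτ hc.2]
        exact outcome_succ_of_eq σ τ ho
    · unfold WinsAfter at hnot
      push Not at hnot
      obtain ⟨y, hy, hyl⟩ := hnot
      obtain ⟨hyp, hyx, hyf⟩ := continues_past_iff.1 hy
      obtain ⟨a, ha⟩ := hyp.exists_actions
      have hl := G.isLegalPlan_script (x := y) fun m => (ha m).1
      have hag := hscript y a hyx hl fun m => (ha m).2
      refine ⟨planProfile hl, ?_, ?_⟩
      · rw [models_subst_iff]
        exact hgood.1 h1 _ (hcont' _ hag)
      · rw [models_subst_iff]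
        suffices outcome σ (planProfile hl) = y by rwa [this]
        refine outcome_eq ((hyx 0 (by omega)).trans hx0) (fun m ho => ?_) fun m _ => ?_
        · rcases lt_or_ge m n with hm | hm
          · rw [past_congr fun l hl => hyx l (by omega), hyx m hm.le, hyx (m + 1) hm]
            exact hf m (by rw [← hyx m hm.le]; exact ho)
          · exact hyf m hm ho
        · rw [joint_planProfile, script_past, (ha m).2]
  · have h0 : G.val i (x n) = 0 := by
      by_contra h0
      exact hbad ⟨fun h => absurd h h1, fun h => absurd h h0⟩
    have hnot : ¬ CanWinAfter σ (past x n) (x n) := fun hw =>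
      hbad ⟨fun h => absurd h h1, fun _ => hw⟩
    refine ⟨fun τ => ?_, ?_⟩
    · rw [models_subst_iff, models_subst_iff]
      intro hw
      by_cases hτ : ∀ m ≤ n, outcome σ τ m = x m
      · exact absurd ⟨_, hcont τ hτ, hw⟩ hnot
      · suffices outcome σ' τ = outcome σ τ by rwa [this]
        refine outcome_eq rfl (fun m ho => ?_) fun m ho => outcome_succ_of_ne σ τ ho
        rw [hσ', switch_act_of_not_agree _ _ fun hc => hτ hc.2]
        exact outcome_succ_of_eq σ τ ho
    · obtain ⟨y, hy, hyw⟩ := hgood.2 h0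
      obtain ⟨hyp, hyx, hyf⟩ := continues_past_iff.1 hy
      obtain ⟨a, ha⟩ := hyp.exists_actions
      have hl := G.isLegalPlan_script (x := y) fun m => (ha m).1
      have hag := hscript y a hyx hl fun m => (ha m).2
      refine ⟨planProfile hl, ?_, ?_⟩
      · rw [models_subst_iff]
        suffices outcome σ' (planProfile hl) = y by rwa [this]
        refine outcome_eq ((hyx 0 (by omega)).trans hx0) (fun m ho => ?_) fun m _ => ?_
        · rcases lt_or_ge m n with hm | hm
          · rw [hσ', switch_act_of_not_agree _ _ fun hc => absurd hc.1 (by omega),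
              past_congr fun l hl => hyx l (by omega), hyx m hm.le, hyx (m + 1) hm]
            exact hf m (by rw [← hyx m hm.le]; exact ho)
          · rw [hσ', switch_act_of_agree _ _ hm hyx]
            exact hyf m hm ho
        · rw [joint_planProfile, script_past, (ha m).2]
      · rw [models_subst_iff]
        exact fun hw => hnot ⟨_, hcont _ hag, hw⟩

/-! ### Outcomes of admissible strategies -/

section AdmissibleOutcomes

variable {σ : G.arena.Strategy i} {x : ℕ → S}

theorem continues_self (hx : G.IsPath x) (hf : G.FollowsOn {i} σ.act x) (n : ℕ) :
    Continues σ (past x n) (x n) x :=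
  continues_past_iff.2 ⟨hx, fun _ _ => rfl, fun m _ hm => hf m hm⟩

/-- An own move cannot raise the value. It cannot lower it either, since the continuations that
achieve the value pass through the chosen successor. -/
theorem val_succ_eq_of_mem_Adm (hσ : σ ∈ G.arena.Adm G.obj i) (hx0 : x 0 = G.init)
    (hx : G.IsPath x) (hf : G.FollowsOn {i} σ.act x) {n : ℕ} (ho : G.owner (x n) = i) :
    G.val i (x (n + 1)) = G.val i (x n) := by
  have hle := G.val_succ_le ho (hx n)
  obtain ⟨hg1, hg0⟩ := achievesVal_of_mem_Adm hσ hx0 hx hf n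
  have h1 : G.val i (x n) = 1 → G.val i (x (n + 1)) = 1 := by
    intro hv
    refine val_eq_one_of_winsAfter hx (σ := σ) fun y hy => hg1 hv y ?_
    obtain ⟨hyp, hyx, hyf⟩ := continues_past_iff.1 hy
    refine continues_past_iff.2 ⟨hyp, fun m hm => hyx m (by omega), fun m hm hom => ?_⟩
    rcases hm.lt_or_eq with hm | rfl
    · exact hyf m hm hom
    · rw [past_congr fun l hl => hyx l (by omega), hyx n (by omega), hyx (n + 1) le_rfl]
      exact hf n ho
  have h0 : G.val i (x n) = 0 → 0 ≤ G.val i (x (n + 1)) := by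
    intro hv
    obtain ⟨y, hy, hyw⟩ := hg0 hv
    obtain ⟨hyp, hyx, hyf⟩ := continues_past_iff.1 hy
    have : y (n + 1) = x (n + 1) := by
      rw [hyf n le_rfl (by rw [hyx n le_rfl]; exact ho), hf n ho, hyx n le_rfl,
        past_congr fun l hl => hyx l (by omega)]
    rw [← this]
    exact nonneg_val_of_path hyp hyw _
  revert hle h1 h0
  cases G.val i (x n) <;> cases G.val i (x (n + 1)) <;> decide

theorem nonneg_val_of_later (hx : G.IsPath x) {n m : ℕ} (hnm : n ≤ m) (h : 0 ≤ G.val i (x m)) :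
    0 ≤ G.val i (x n) := by
  induction m, hnm using Nat.le_induction with
  | base => exact h
  | succ m _ ih => exact ih (G.nonneg_val_of_succ (hx m) h)

theorem mem_M_of_mem_Adm (hσ : σ ∈ G.arena.Adm G.obj i) {ρ : Run S A} (hx0 : ρ.st 0 = G.init)
    (hx : G.IsPath ρ.st) (hf : G.FollowsOn {i} σ.act ρ.st) : ρ ∈ G.M i := by
  have hgood := achievesVal_of_mem_Adm hσ hx0 hx hf
  have hone : ∀ n, G.val i (ρ.st n) = 1 → infSet ρ.st ∈ G.F i := fun n hv =>
    (hgood n).1 hv _ (continues_self hx hf n)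
  refine ⟨fun h => ?_, fun h => or_iff_not_imp_left.2 fun hlose => by_contra fun hH => ?_⟩
  · obtain ⟨n, hn⟩ := h.exists
    exact hone n hn
  · obtain ⟨N, hN⟩ := eventually_atTop.1 (not_frequently.1 hH)
    obtain ⟨n, hn, hv⟩ := frequently_atTop.1 h N
    obtain ⟨y, hy, hyw⟩ := (hgood n).2 hv
    obtain ⟨hyp, hyx, hyf⟩ := continues_past_iff.1 hy
    -- Past the last help state the winning continuation cannot branch off the losing run. A
    -- branching state of another player would have value `0` and two distinct successors of
    -- nonnegative value: one lies on the winning path, and from the other the run returns to value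
    -- `0`.
    have hEq : ∀ m, y m = ρ.st m := by
      intro m
      refine eq_of_step_eq (n := m) (hyx 0 (by omega)) (fun j _ hpast hst => ?_) m le_rfl
      rcases lt_or_ge j n with hj | hj
      · exact hyx _ hj
      by_cases ho : G.owner (y j) = i
      · rw [hyf j hj ho, hpast, hst]
        exact (hf j (by rw [← hst]; exact ho)).symm
      by_contra hne
      refine hN j (hn.trans hj) ⟨by rwa [← hst], ?_, _, hst ▸ hyp j, _, hx j, hne,
        nonneg_val_of_path hyp hyw _, ?_⟩
      · have h1 : G.val i (ρ.st j) ≠ 1 := fun h => hlose (hone j h)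
        have h2 : 0 ≤ G.val i (ρ.st j) := hst ▸ nonneg_val_of_path hyp hyw j
        revert h1 h2
        cases G.val i (ρ.st j) <;> decide
      · obtain ⟨l, hl, hvl⟩ := frequently_atTop.1 h (j + 1)
        exact nonneg_val_of_later hx hl hvl.ge
    exact hlose (by rw [mem_obj, ← funext hEq]; exact hyw)

end AdmissibleOutcomes

/-- A strategy winning the product game wins against admissible strategies. -/
theorem winsAgainstAdm_of_wins_prod {k : P} {σ : G.arena.Strategy k}
    (h : (G.prodArena k).WinsFrom (G.prodArena k).init (G.liftStrategy k σ) (G.Omega' k)) :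
    G.arena.WinsAgainstAdm G.obj σ := by
  intro τ hτ
  rw [models_subst_iff]
  set x := outcome σ τ with hxdef
  have hx : G.IsPath x := isPath_outcome σ τ
  let a : ℕ → A := fun n => joint (G.arena.subst σ τ) (past x n) (x n)
  have ha : ∀ n, x (n + 1) = G.δ (x n) (a n) := fun n => G.play_succ _ _ n
  let g : ℕ → Flag := fun n => Nat.rec .zero (fun n f => G.flagStep k (x n) (a n) f) n
  have hfol : ∀ j, j ≠ k → G.FollowsOn {j} (τ j).act x := by
    rintro j hj n rfl
    rw [ha]
    simp only [a]
    rw [joint_subst_of_ne σ τ hj]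
    rfl
  have hΩ := h ⟨fun n => (x n, g n), a⟩ (fun n => ⟨isLegalPlan_joint _ _ _, by
      simp only [prodArena, ← ha n]; rfl⟩) rfl fun n hn => by
    simp only [liftStrategy, Abstraction.map_past]
    exact joint_subst_of_eq σ τ hn
  have hE : ∀ n j, j ≠ k → (x n, a n) ∈ G.E j := by
    intro n j hj ho
    rw [← ha n]
    exact val_succ_eq_of_mem_Adm (hτ j hj) rfl hx (hfol j hj) ho
  -- Only a value change by another player raises the flag to `⊤`, and admissible strategies never
  -- make one.
  have htop : ∀ n, g n ≠ .top := by
    intro n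
    induction n with
    | zero => simp [g]
    | succ n ih =>
      change G.flagStep k (x n) (a n) (g n) ≠ .top
      cases hgn : g n with
      | bot => simp [flagStep]
      | top => exact absurd hgn ih
      | zero =>
        rw [flagStep]
        split_ifs with h1 h2
        · obtain ⟨j, hj, hjE⟩ := h2
          exact absurd (hE n j hj) hjE
        · simp
        · simp
  rcases hΩ with ⟨-, -, h1⟩ | ⟨h1, -⟩
  · exact h1 fun j hj => mem_M_of_mem_Adm (ρ := ⟨x, a⟩) (hτ j hj) rfl hx (hfol j hj)
  · obtain ⟨n, hn⟩ := h1.exists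
    exact absurd hn (htop n)

/-! ### Improving a strategy to an admissible one -/

open Classical in
/-- Replace a strategy that does not achieve the value after the history `l, s` by one that does. -/
noncomputable def improve (σ : G.arena.Strategy i) (l : List S) (s : S) : G.arena.Strategy i :=
  if AchievesVal σ l s then σ
  else if h : ∃ σ' : G.arena.Strategy i, AchievesVal σ' l s then h.choose else σ

/-- The strategy in use after a history, when the initial strategy `σ` is replaced as soon as it
does not achieve the value, and so on. -/
noncomputable def current (σ : G.arena.Strategy i) : List S → S → G.arena.Strategy i
  | [], s => improve σ [] s
  | q :: h, s => improve (current σ h q) (q :: h) s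

/-- Follow at every moment the current strategy. -/
noncomputable def improved (σ : G.arena.Strategy i) : G.arena.Strategy i where
  act h s := (current σ h s).act h s
  legal h s hs := (current σ h s).legal h s hs

variable {σ : G.arena.Strategy i}

theorem improve_of_achievesVal {l : List S} {s : S} (h : AchievesVal σ l s) : improve σ l s = σ :=
  if_pos h

theorem achievesVal_improve (σ : G.arena.Strategy i) {x : ℕ → S} (hx : G.IsPath x) (n : ℕ) :
    AchievesVal (improve σ (past x n) (x n)) (past x n) (x n) := by
  unfold improve
  have h2 := exists_achievesVal i hx n
  split_ifs with h1
  · exact h1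
  · exact h2.choose_spec

theorem achievesVal_current (σ : G.arena.Strategy i) {x : ℕ → S} (hx : G.IsPath x) (n : ℕ) :
    AchievesVal (current σ (past x n) (x n)) (past x n) (x n) := by
  cases n with
  | zero => exact achievesVal_improve σ hx 0
  | succ n => exact achievesVal_improve _ hx (n + 1)

theorem current_succ (σ : G.arena.Strategy i) (x : ℕ → S) (n : ℕ) :
    current σ (past x (n + 1)) (x (n + 1)) =
      improve (current σ (past x n) (x n)) (past x (n + 1)) (x (n + 1)) := rfl

/-- Shifting the reference history along a path that follows the strategy. -/
theorem Continues.of_later {σ : G.arena.Strategy i} {x y z : ℕ → S} {n m : ℕ} (hnm : n ≤ m)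
    (hyx : ∀ j ≤ n, y j = x j)
    (hyf : ∀ j, n ≤ j → j < m → G.owner (y j) = i →
      y (j + 1) = G.δ (y j) (σ.act (past y j) (y j)))
    (hz : Continues σ (past y m) (y m) z) : Continues σ (past x n) (x n) z := by
  obtain ⟨hzp, hzy, hzf⟩ := continues_past_iff.1 hz
  refine continues_past_iff.2 ⟨hzp, fun j hj => (hzy j (by omega)).trans (hyx j hj),
    fun j hj ho => ?_⟩
  rcases lt_or_ge j m with hjm | hjm
  · rw [past_congr fun l hl => hzy l (by omega), hzy j hjm.le, hzy (j + 1) hjm]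
    exact hyf j hj hjm (by rw [← hzy j hjm.le]; exact ho)
  · exact hzf j hjm ho

theorem winsAfter_improved {x : ℕ → S} {n : ℕ} (hv : G.val i (x n) = 1) (hx : G.IsPath x) :
    WinsAfter (improved σ) (past x n) (x n) := by
  have hw := (achievesVal_current σ hx n).1 hv
  set c := current σ (past x n) (x n) with hc
  intro y hy
  obtain ⟨hyp, hyx, hyf⟩ := continues_past_iff.1 hy
  -- A strategy winning after a history still wins after every later history that follows it, so it
  -- is never replaced.
  have hconst : ∀ m, n ≤ m → ∀ j, n ≤ j → j ≤ m → current σ (past y j) (y j) = c := by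
    intro m hm
    induction m, hm using Nat.le_induction with
    | base =>
      intro j h1 h2
      obtain rfl : j = n := le_antisymm h2 h1
      rw [hc, past_congr fun l hl => hyx l hl.le, hyx j le_rfl]
    | succ m hm ih =>
      intro j h1 h2
      rcases h2.lt_or_eq with h2 | rfl
      · exact ih j h1 (by omega)
      rw [current_succ, ih m hm le_rfl]
      refine improve_of_achievesVal (WinsAfter.achievesVal hyp fun z hz => hw z ?_)
      refine Continues.of_later (by omega) hyx (fun j hj1 hj2 ho => ?_) hz
      rw [← ih j hj1 (by omega)]
      exact hyf j hj1 ho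
  refine hw y (continues_past_iff.2 ⟨hyp, hyx, fun m hm ho => ?_⟩)
  rw [← hconst m hm m hm le_rfl]
  exact hyf m hm ho

/-- The strategy in use is given up along a winning path only at states of value `1`. -/
theorem val_eq_one_of_not_achievesVal {c : G.arena.Strategy i} {y : ℕ → S} {m : ℕ}
    (hy : Continues c (past y m) (y m) y) (hw : infSet y ∈ G.F i)
    (h : ¬ AchievesVal c (past y m) (y m)) : G.val i (y m) = 1 := by
  by_contra hv
  exact h ⟨fun h => absurd h hv, fun _ => ⟨y, hy, hw⟩⟩

/-- For value `0`, take a winning path of the strategy in use. If that strategy is kept along the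
whole path, the improved strategy follows it. Otherwise the first replacement occurs at a state of
value `1`, where the improved strategy wins. -/
theorem achievesVal_improved {x : ℕ → S} (hx : G.IsPath x) (n : ℕ) :
    AchievesVal (improved σ) (past x n) (x n) := by
  refine ⟨fun hv => winsAfter_improved hv hx, fun hv => ?_⟩
  obtain ⟨y, hy, hyw⟩ := (achievesVal_current σ hx n).2 hv
  set c := current σ (past x n) (x n) with hc
  obtain ⟨hyp, hyx, hyf⟩ := continues_past_iff.1 hy
  by_cases hall : ∀ m ≥ n, current σ (past y m) (y m) = c
  · refine ⟨y, continues_past_iff.2 ⟨hyp, hyx, fun m hm ho => ?_⟩, hyw⟩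
    rw [hyf m hm ho, ← hall m hm]
    rfl
  · classical
    push Not at hall
    have hspec := Nat.find_spec hall
    have hmin : ∀ j ≥ n, j < Nat.find hall → current σ (past y j) (y j) = c := fun j h1 h2 =>
      by_contra fun h3 => Nat.find_min hall h2 ⟨h1, h3⟩
    set m := Nat.find hall
    have hyn : current σ (past y n) (y n) = c := by
      rw [hc, past_congr fun l hl => hyx l hl.le, hyx n le_rfl]
    have hnm : n < m := lt_of_le_of_ne hspec.1 fun h => hspec.2 (h ▸ hyn)
    obtain ⟨j, hj⟩ : ∃ j, m = j + 1 := Nat.exists_eq_succ_of_ne_zero (by omega)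
    have hv1 : G.val i (y m) = 1 := by
      refine val_eq_one_of_not_achievesVal (c := c) (continues_past_iff.2 ⟨hyp, fun _ _ => rfl,
        fun l hl => hyf l (by omega)⟩) hyw fun hg => hspec.2 ?_
      rw [hj, current_succ, hmin j (by omega) (by omega), ← hj]
      exact improve_of_achievesVal hg
    obtain ⟨z, hz⟩ := exists_continues (improved σ) hyp m
    refine ⟨z, hz.of_later hnm.le hyx fun l h1 h2 ho => ?_, winsAfter_improved hv1 hyp z hz⟩
    rw [hyf l h1 ho, ← hmin l h1 h2]
    rfl

theorem improved_mem_Adm (σ : G.arena.Strategy i) : improved σ ∈ G.arena.Adm G.obj i :=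
  mem_Adm_of_achievesVal fun _ _ hx _ n => achievesVal_improved hx n

/-- The improved strategy wins whenever the original one does. -/
theorem models_improved (τ : G.arena.Profile)
    (h : G.arena.Models (G.arena.subst σ τ) (G.obj i)) :
    G.arena.Models (G.arena.subst (improved σ) τ) (G.obj i) := by
  rw [models_subst_iff] at h ⊢
  set y := outcome σ τ with hydef
  have hyp : G.IsPath y := isPath_outcome σ τ
  -- Either `σ` is never replaced along its winning outcome and the outcome is unchanged, or the
  -- first replacement is at a state of value `1`, possibly already the initial state.
  by_cases hall : ∀ m, current σ (past y m) (y m) = σ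
  · suffices outcome (improved σ) τ = y by rwa [this]
    refine outcome_eq rfl (fun m ho => ?_) fun m ho => outcome_succ_of_ne σ τ ho
    change _ = G.δ _ ((current σ _ _).act _ _)
    rw [hall m]
    exact outcome_succ_of_eq σ τ ho
  · classical
    push Not at hall
    have hspec := Nat.find_spec hall
    have hmin : ∀ j < Nat.find hall, current σ (past y j) (y j) = σ := fun j h2 =>
      by_contra fun h3 => Nat.find_min hall h2 h3
    set m := Nat.find hall
    have hv1 : G.val i (y m) = 1 := by
      refine val_eq_one_of_not_achievesVal (c := σ) (continues_past_iff.2 ⟨hyp, fun _ _ => rfl,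
        fun l _ ho => outcome_succ_of_eq σ τ ho⟩) h fun hg => hspec ?_
      rcases Nat.eq_zero_or_eq_succ_pred m with h0 | h0
      · rw [h0] at hg ⊢
        exact improve_of_achievesVal hg
      · rw [h0] at hg ⊢
        rw [current_succ, hmin _ (by omega)]
        exact improve_of_achievesVal hg
    refine winsAfter_improved hv1 hyp _ (continues_past_iff.2 ⟨isPath_outcome _ τ, ?_,
      fun l _ ho => outcome_succ_of_eq _ τ ho⟩)
    refine outcome_eq_of_le rfl (fun l hl ho => ?_) fun l _ ho => outcome_succ_of_ne σ τ ho
    change _ = G.δ _ ((current σ _ _).act _ _)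
    rw [hmin l hl]
    exact outcome_succ_of_eq σ τ ho

theorem improved_AAWinning (h : G.arena.WinsAgainstAdm G.obj σ) :
    G.arena.AAWinning G.obj (improved σ) :=
  ⟨improved_mem_Adm σ, fun τ hτ => models_improved τ (h τ hτ)⟩

end MullerGame

end AssumeAdmissible

theorem mainTheorem4 {P S A T : Type*} [Finite P] [Finite S] [Finite T]
    (G : MullerGame P S A) (abs : Abstraction G T) (hobj : abs.CompatibleObjectives)
    (k : P) (hinit : abs.α G.init ∈ abs.VlowAll k)
    (σ : (abs.prodArena k).Strategy Side.anti)
    (hσ : (abs.prodArena k).WinsFrom (abs.prodArena k).init σ (abs.OmegaLow k)) :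
    (∀ c : S → S → A, G.IsEdgeLabelling c →
      (G.prodArena k).WinsFrom (G.prodArena k).init
          (G.liftStrategy k (abs.concretize k c σ)) (G.Omega' k) ∧
        G.arena.WinsAgainstAdm G.obj (abs.concretize k c σ)) ∧
      ∃ σ' : G.arena.Strategy k, G.arena.AAWinning G.obj σ' := by
  have key : ∀ c : S → S → A, G.IsEdgeLabelling c →
      (G.prodArena k).WinsFrom (G.prodArena k).init
          (G.liftStrategy k (abs.concretize k c σ)) (G.Omega' k) ∧
        G.arena.WinsAgainstAdm G.obj (abs.concretize k c σ) := fun c hc =>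
    have h := Abstraction.concretize_wins hobj hinit hσ hc
    ⟨h, MullerGame.winsAgainstAdm_of_wins_prod h⟩
  obtain ⟨c, hc⟩ := G.exists_isEdgeLabelling
  exact ⟨key, _, MullerGame.improved_AAWinning (key c hc).2⟩
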